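/- Let $d\ge 1$ and let $\mathbb T^d=(\mathbb R/2\pi\mathbb Z)^d$. For $1\le p<\infty$ let $L_p(\mathbb T^d)$ be the space of real-valued measurable functions on $\mathbb T^d$ with $\|f\|_p=\big(\int_{\mathbb T^d}|f(x)|^p\,dx\big)^{1/p}<\infty$, and let $L_\infty(\mathbb T^d)$ denote the space of real-valued continuous functions on $\mathbb T^d$ with the maximum norm. For $\beta,\delta>0$ and $n\in\mathbb N$ let $$\mathcal R_n^{\beta,\delta}(x)=\sum_{k\in\mathbb Z^d}\Big(1-\frac{|k|^\beta}{n^\beta}\Big)_+^\delta e^{i(k,x)},\qquad \mathcal S_n^{\beta,\delta}(f;x)=(2\pi)^{-d}\int_{\mathbb T^d}f(x+y)\,\mathcal R_n^{\beta,\delta}(y)\,dy,$$ where $|\cdot|$ is the Euclidean norm and $t_+=\max\{t,0\}$, and let $\mathcal S_n^{\delta}=\mathcal S_n^{2,\delta}$ be the classical Bochner–Riesz means. Operators $\mathcal L_n$ are said to converge in $L_p$ if $\lim_{n\to\infty}\|f-\mathcal L_n(f)\|_p=0$ for every $f\in L_p(\mathbb T^d)$, and to diverge in $L_p$ otherwise.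 Put $$\Sigma(d)=\Big\{(u,\delta)\in[0,\infty)^2:\ \delta>\max\Big\{\tfrac{d-1}2,\ d\big(u-\tfrac12\big)-\tfrac12\Big\}\Big\},\qquad \Gamma(d)=\Big\{(u,\delta)\in[0,\infty)^2:\ \delta\le d\,\big|u-\tfrac12\big|-\tfrac12\Big\}.$$ Let $1\le p\le\infty$ and $\beta,\delta>0$, with $1/p=0$ for $p=\infty$. Then the means $\mathcal S_n^{\beta,\delta}$ converge in $L_p$ if and only if the means $\mathcal S_n^{\delta}$ converge in $L_p$. In particular, the means $\mathcal S_n^{\beta,\delta}$ converge in $L_p$ if $(1/p,\delta)\in\Sigma(d)$, and they diverge in $L_p$ if $(1/p,\delta)\in\Gamma(d)$. -/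

import Mathlib

open MeasureTheory Filter Topology
open scoped ENNReal

noncomputable section

namespace BochnerRiesz

instance fact_two_pi_pos : Fact (0 < 2 * Real.pi) := ⟨Real.two_pi_pos⟩

/-- The `d`-dimensional torus `(ℝ / 2πℤ)^d`. Functions on it are the functions on `ℝ^d` that are
`2π`-periodic in each variable, and its `volume` is Lebesgue measure on `[0, 2π)^d`
(total mass `(2π)^d`). -/
abbrev Torus (d : ℕ) : Type := Fin d → AddCircle (2 * Real.pi)

/-- The Euclidean length `|k|` of `k ∈ ℤ^d`. -/
def eucl {d : ℕ} (k : Fin d → ℤ) : ℝ := Real.sqrt (∑ j, (k j : ℝ) ^ 2)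

/-- The character `x ↦ e^{i(k,x)} = ∏ⱼ e^{i kⱼ xⱼ}` of the torus. -/
def character {d : ℕ} (k : Fin d → ℤ) (x : Torus d) : ℂ := ∏ j, fourier (k j) (x j)

/-- The generalized Bochner–Riesz kernel `∑_{k ∈ ℤ^d} (1 - |k|^β / n^β)_+^δ e^{i(k,x)}`.
For `n ≥ 1` and `β, δ > 0` only finitely many terms are nonzero. -/
def kernel (d : ℕ) (β δ : ℝ) (n : ℕ) (x : Torus d) : ℂ :=
  ∑' k : Fin d → ℤ,
    (((max (1 - eucl k ^ β / (n : ℝ) ^ β) 0) ^ δ : ℝ) : ℂ) * character k x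

/-- The generalized Bochner–Riesz mean `(2π)^{-d} ∫_{𝕋^d} f(x + y) R_n^{β,δ}(y) dy`. -/
def mean (d : ℕ) (β δ : ℝ) (n : ℕ) (f : Torus d → ℝ) (x : Torus d) : ℂ :=
  (((2 * Real.pi) ^ d : ℝ) : ℂ)⁻¹ * ∫ y : Torus d, (f (x + y) : ℂ) * kernel d β δ n y

/-- The classical Bochner–Riesz mean, the case `β = 2`. -/
def classicalMean (d : ℕ) (δ : ℝ) (n : ℕ) (f : Torus d → ℝ) (x : Torus d) : ℂ :=
  mean d 2 δ n f x

/-- Membership in the space `L_p(𝕋^d)` of real-valued functions; for `p = ∞` this is, by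
convention, the space of continuous functions. -/
def InLp {d : ℕ} (p : ℝ≥0∞) (f : Torus d → ℝ) : Prop :=
  if p = ∞ then Continuous f else MemLp f p volume

/-- The operators `L n` converge in `L_p(𝕋^d)`: `‖f - L n f‖_p → 0` for every `f ∈ L_p(𝕋^d)`.
For `p = ∞` the functions involved are continuous, so the essential supremum is the maximum. -/
def ConvergesInLp {d : ℕ} (p : ℝ≥0∞) (L : ℕ → (Torus d → ℝ) → Torus d → ℂ) : Prop :=
  ∀ f : Torus d → ℝ, InLp p f →
    Tendsto (fun n => eLpNorm (fun x => (f x : ℂ) - L n f x) p volume) atTop (𝓝 0)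

/-- The region `Σ(d)` of pairs `(1/p, δ)`. -/
def SigmaRegion (d : ℕ) : Set (ℝ × ℝ) :=
  {q | 0 ≤ q.1 ∧ 0 ≤ q.2 ∧
    max (((d : ℝ) - 1) / 2) ((d : ℝ) * (q.1 - 1 / 2) - 1 / 2) < q.2}

/-- The region `Γ(d)` of pairs `(1/p, δ)`. -/
def GammaRegion (d : ℕ) : Set (ℝ × ℝ) :=
  {q | 0 ≤ q.1 ∧ 0 ≤ q.2 ∧ q.2 ≤ (d : ℝ) * |q.1 - 1 / 2| - 1 / 2}

end BochnerRiesz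

end

/-!
The means are Fourier multiplier operators with symbols `(1 - |k|^β / n^β)₊^δ`. They converge on
trigonometric polynomials, so by Banach–Steinhaus they converge in `L_p` if and only if their
symbols are multipliers of `L_p` uniformly in `n`.

*Positive results.* For `δ > (d - 1) / 2` the kernel of `(1 - |ξ|²)₊^δ` is integrable on `ℝ^d`, and
periodizing it gives uniform bounds. By Taylor's formula with integral remainder, a smooth compactly
supported function of a power of `|ξ|` is an average of dilated Riesz symbols of large order, hence
a multiplier as well. With `v = |k|² / n²`, passing from one exponent to another multiplies the
symbol by `((1 - v^b) / (1 - v^b'))^δ`, which is smooth near `v = 1`, while near `v = 0` it is a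
product of smooth functions of `v^b` and of `v^b'`. Both are multipliers, and the two exponents are
interchangeable.

*Negative results.* It remains to treat `β = 2`. Duality, applied to de la Vallée Poussin kernels
and to functions of the rescaled variable `n x`, turns a uniform bound into a bound on `ℝ^d` for the
integral of the Riesz kernel against a radial profile. The profile made of the kernel's own Bessel
function, cut off to `1 ≤ |y| ≤ R`, makes this integral grow like `log R`, but on and below the
critical line its norm is only `O(√(log R))`.
-/

noncomputable section

namespace BochnerRiesz

/-! ### Multipliers along a family of vectors -/

section MultiplierBound

variable {𝕜 X ι : Type*} [RCLike 𝕜] [NormedAddCommGroup X] [NormedSpace 𝕜 X] {e : ι → X}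

/-- The multiplier `m`, acting on finite linear combinations of the vectors `e k` by
`e k ↦ m k • e k`, has operator norm at most `C`. Since the `e k` need not be linearly independent,
this is stated for the coefficients and not for a linear map. -/
def MultiplierBound (e : ι → X) (C : ℝ) (m : ι → 𝕜) : Prop :=
  ∀ (s : Finset ι) (c : ι → 𝕜), ‖∑ k ∈ s, (m k * c k) • e k‖ ≤ C * ‖∑ k ∈ s, c k • e k‖

variable {C C₁ C₂ : ℝ} {m m₁ m₂ : ι → 𝕜}

theorem MultiplierBound.mono (h : MultiplierBound e C₁ m) (hC : C₁ ≤ C₂) :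
    MultiplierBound e C₂ m :=
  fun s c => (h s c).trans (mul_le_mul_of_nonneg_right hC (norm_nonneg _))

theorem MultiplierBound.mul (h₁ : MultiplierBound e C₁ m₁) (h₂ : MultiplierBound e C₂ m₂)
    (hC : 0 ≤ C₁) : MultiplierBound e (C₁ * C₂) (fun k => m₁ k * m₂ k) := by
  intro s c
  simp only [mul_assoc]
  exact (h₁ s fun k => m₂ k * c k).trans (mul_le_mul_of_nonneg_left (h₂ s c) hC)

theorem MultiplierBound.add (h₁ : MultiplierBound e C₁ m₁) (h₂ : MultiplierBound e C₂ m₂) :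
    MultiplierBound e (C₁ + C₂) (fun k => m₁ k + m₂ k) := by
  intro s c
  simp only [add_mul, add_smul, Finset.sum_add_distrib]
  exact (norm_add_le _ _).trans (add_le_add (h₁ s c) (h₂ s c))

theorem MultiplierBound.integral {S : Type*} [MeasurableSpace S] {μ : Measure S}
    [NormedSpace ℝ X] [CompleteSpace X] {f : S → 𝕜} {g : S → ι → 𝕜} (hf : Integrable f μ)
    (hg : ∀ᵐ t ∂μ, MultiplierBound e C (g t))
    (hfg : ∀ k, Integrable (fun t => f t * g t k) μ) (hm : ∀ k, m k = ∫ t, f t * g t k ∂μ) :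
    MultiplierBound e ((∫ t, ‖f t‖ ∂μ) * C) m := by
  intro s c
  have hsum : ∑ k ∈ s, (m k * c k) • e k = ∫ t, ∑ k ∈ s, (f t * g t k * c k) • e k ∂μ := by
    rw [integral_finsetSum _ fun k _ => ((hfg k).mul_const (c k)).smul_const _]
    refine Finset.sum_congr rfl fun k _ => ?_
    rw [integral_smul_const, integral_mul_const, hm]
  rw [hsum, mul_assoc, ← integral_mul_const]
  refine norm_integral_le_of_norm_le (hf.norm.mul_const _) ?_
  filter_upwards [hg] with t ht
  simp only [mul_assoc, mul_smul (f t), ← Finset.smul_sum, norm_smul]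
  exact mul_le_mul_of_nonneg_left (ht s c) (norm_nonneg _)

theorem MultiplierBound.norm_le_of_mem_closure_span (h : MultiplierBound e C m) (S : X →L[𝕜] X)
    (hS : ∀ k, S (e k) = m k • e k)
    {g : X} (hg : g ∈ (Submodule.span 𝕜 (Set.range e)).topologicalClosure) :
    ‖S g‖ ≤ C * ‖g‖ := by
  have hclosed : IsClosed {g : X | ‖S g‖ ≤ C * ‖g‖} := isClosed_le (by fun_prop) (by fun_prop)
  refine closure_minimal (fun x hx => ?_) hclosed hg
  obtain ⟨c, rfl⟩ := Finsupp.mem_span_range_iff_exists_finsupp.1 hx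
  simpa [Finsupp.sum, hS, smul_smul, mul_comm] using h c.support c

theorem multiplierBound_of_norm_le (S : X →L[𝕜] X) (hS : ∀ k, S (e k) = m k • e k)
    (h : ∀ g ∈ Submodule.span 𝕜 (Set.range e), ‖S g‖ ≤ C * ‖g‖) : MultiplierBound e C m := by
  intro s c
  simpa [hS, smul_smul, mul_comm] using h _ (Submodule.sum_mem _ fun k _ =>
    Submodule.smul_mem _ (c k) (Submodule.subset_span ⟨k, rfl⟩))

theorem exists_multiplierBound_of_tendsto [CompleteSpace X] {S : ℕ → X →L[𝕜] X} {m : ℕ → ι → 𝕜}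
    (hS : ∀ n k, S n (e k) = m n k • e k)
    (h : ∀ g ∈ (Submodule.span 𝕜 (Set.range e)).topologicalClosure,
      ∃ x, Tendsto (fun n => S n g) atTop (𝓝 x)) :
    ∃ C, ∀ n, MultiplierBound e C (m n) := by
  set E := (Submodule.span 𝕜 (Set.range e)).topologicalClosure
  have : CompleteSpace E := (Submodule.isClosed_topologicalClosure _).completeSpace_coe
  have hbdd : ∀ x : E, ∃ C, ∀ n, ‖((S n).comp E.subtypeL) x‖ ≤ C := fun x =>
    let ⟨_, hx⟩ := h x x.2
    let ⟨C, hC⟩ := hx.norm.bddAbove_range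
    ⟨C, fun n => hC ⟨n, rfl⟩⟩
  obtain ⟨C, hC⟩ := banach_steinhaus hbdd
  refine ⟨C, fun n => multiplierBound_of_norm_le (S n) (hS n) fun g hg => ?_⟩
  exact ((S n).comp E.subtypeL).le_of_opNorm_le (hC n)
    (⟨g, Submodule.le_topologicalClosure _ hg⟩ : E)

theorem tendsto_of_multiplierBound {S : ℕ → X →L[𝕜] X} {m : ℕ → ι → 𝕜}
    (hS : ∀ n k, S n (e k) = m n k • e k) (hC : ∀ n, MultiplierBound e C (m n))
    (hm : ∀ k, Tendsto (fun n => m n k) atTop (𝓝 1)) {g : X}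
    (hg : g ∈ (Submodule.span 𝕜 (Set.range e)).topologicalClosure) :
    Tendsto (fun n => S n g) atTop (𝓝 g) := by
  set E := (Submodule.span 𝕜 (Set.range e)).topologicalClosure
  have hequi : Equicontinuous (fun n => ⇑((S n).comp E.subtypeL)) := by
    refine ((NormedSpace.equicontinuous_TFAE fun n => (S n).comp E.subtypeL).out 1 3).2 ?_
    exact ⟨C, fun n x => (hC n).norm_le_of_mem_closure_span (S n) (hS n) x.2⟩
  have hspan : ∀ x ∈ Submodule.span 𝕜 (Set.range e), Tendsto (fun n => S n x) atTop (𝓝 x) := by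
    intro x hx
    induction hx using Submodule.span_induction with
    | mem _ h =>
      obtain ⟨k, rfl⟩ := h
      simpa [hS] using (hm k).smul_const (e k)
    | zero => simp
    | add _ _ _ _ hx hy => simpa using hx.add hy
    | smul a _ _ hx => simpa using hx.const_smul a
  refine closure_minimal (s := Subtype.val ⁻¹' (Submodule.span 𝕜 (Set.range e) : Set X))
    (fun x hx => hspan x hx) (hequi.isClosed_setOfPred_tendsto continuous_subtype_val)
    (closure_subtype.2 ?_ : (⟨g, hg⟩ : E) ∈ _)
  rw [Set.image_preimage_eq_of_subset fun x hx =>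
    ⟨⟨x, Submodule.le_topologicalClosure _ hx⟩, rfl⟩]
  exact hg

end MultiplierBound

theorem norm_toLp_top {Y E 𝕜 : Type*} [TopologicalSpace Y] [CompactSpace Y] [MeasurableSpace Y]
    [BorelSpace Y] [NormedAddCommGroup E] [SecondCountableTopologyEither Y E]
    [NormedField 𝕜] [NormedSpace 𝕜 E] (μ : Measure Y) [IsFiniteMeasure μ] [μ.IsOpenPosMeasure]
    (h : C(Y, E)) : ‖ContinuousMap.toLp ∞ μ 𝕜 h‖ = ‖h‖ := by
  have hcoe := ContinuousMap.coeFn_toLp (p := ∞) (𝕜 := 𝕜) μ h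
  refine le_antisymm ?_ ((ContinuousMap.norm_le _ (norm_nonneg _)).2 fun x => ?_)
  · have hbound : ∀ᵐ x ∂μ, ‖ContinuousMap.toLp ∞ μ 𝕜 h x‖ ≤ ‖h‖ := by
      filter_upwards [hcoe] with x hx using hx ▸ h.norm_coe_le_norm x
    simpa using Lp.norm_le_of_ae_bound (norm_nonneg h) hbound
  · have hbound : ∀ᵐ x ∂μ, ‖h x‖ ≤ ‖ContinuousMap.toLp ∞ μ 𝕜 h‖ := by
      filter_upwards [hcoe, ae_le_eLpNormEssSup (f := ContinuousMap.toLp ∞ μ 𝕜 h) (μ := μ)]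
        with x hx hle
      rw [← hx, Lp.norm_def, eLpNorm_exponent_top, ← toReal_enorm]
      exact ENNReal.toReal_mono (eLpNorm_exponent_top (f := ContinuousMap.toLp ∞ μ 𝕜 h) ▸
        Lp.eLpNorm_ne_top _) hle
    have hclosed : IsClosed {x | ‖h x‖ ≤ ‖ContinuousMap.toLp ∞ μ 𝕜 h‖} :=
      isClosed_le (by fun_prop) continuous_const
    exact hclosed.closure_subset ((Measure.dense_of_ae hbound) x)

variable {d : ℕ}

/-! ### Characters of the torus -/

theorem character_add_right (k : Fin d → ℤ) (x y : Torus d) :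
    character k (x + y) = character k x * character k y := by
  simp only [character, ← Finset.prod_mul_distrib]
  refine Finset.prod_congr rfl fun j _ => ?_
  simp [fourier_apply, AddCircle.toCircle_add, smul_add]

theorem character_add (k l : Fin d → ℤ) (x : Torus d) :
    character (k + l) x = character k x * character l x := by
  simp only [character, ← Finset.prod_mul_distrib]
  exact Finset.prod_congr rfl fun j _ => by simp

theorem character_neg (k : Fin d → ℤ) (x : Torus d) :
    character (-k) x = starRingEnd ℂ (character k x) := by
  simp [character, map_prod]

theorem character_zero (x : Torus d) : character 0 x = 1 := by
  simp [character]

theorem norm_character (k : Fin d → ℤ) (x : Torus d) : ‖character k x‖ = 1 := by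
  simp only [character, norm_prod, fourier_apply]
  exact Finset.prod_eq_one fun j _ => Circle.norm_coe _

theorem continuous_character (k : Fin d → ℤ) : Continuous (character k : Torus d → ℂ) := by
  unfold character
  fun_prop

/-- The projection `ℝ^d → 𝕋^d`. -/
def toTorus (y : Fin d → ℝ) : Torus d := fun j => (y j : AddCircle (2 * Real.pi))

theorem character_toTorus (k : Fin d → ℤ) (y : Fin d → ℝ) :
    character k (toTorus y) = Complex.exp (Complex.I * ((∑ j, (k j : ℝ) * y j : ℝ) : ℂ)) := by
  simp only [character, toTorus, fourier_coe_apply]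
  rw [← Complex.exp_sum]
  congr 1
  push_cast
  rw [Finset.mul_sum]
  refine Finset.sum_congr rfl fun j _ => ?_
  have : (Real.pi : ℂ) ≠ 0 := by exact_mod_cast Real.pi_ne_zero
  field_simp

theorem integral_fourier {T : ℝ} [hT : Fact (0 < T)] (n : ℤ) :
    ∫ t : AddCircle T, fourier n t = if n = 0 then (T : ℂ) else 0 := by
  split_ifs with h
  · subst h
    simp [measureReal_def, AddCircle.measure_univ, hT.out.le]
  · exact integral_eq_zero_of_add_right_eq_neg (g := ((T / 2 / n : ℝ) : AddCircle T))
      (fourier_add_half_inv_index h hT.out)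

theorem integral_character (k : Fin d → ℤ) :
    ∫ x : Torus d, character k x = if k = 0 then (((2 * Real.pi) ^ d : ℝ) : ℂ) else 0 := by
  unfold character
  rw [integral_fintype_prod_volume_eq_prod (fun j => fun t : AddCircle (2 * Real.pi) =>
    (fourier (k j) t : ℂ))]
  simp only [integral_fourier]
  split_ifs with h
  · subst h; simp
  · obtain ⟨j, hj⟩ := Function.ne_iff.1 h
    exact Finset.prod_eq_zero (Finset.mem_univ j) (if_neg hj)

/-- The characters as continuous maps. -/
def characterMap (k : Fin d → ℤ) : C(Torus d, ℂ) := ⟨character k, continuous_character k⟩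

@[simp]
theorem characterMap_apply (k : Fin d → ℤ) (x : Torus d) :
    characterMap k x = character k x := rfl

/-- The rescaling of `(ℝ / 2πℤ)^d` to `(ℝ / ℤ)^d`. -/
def toUnitAddTorus (d : ℕ) : Torus d ≃ₜ UnitAddTorus (Fin d) :=
  Homeomorph.piCongrRight fun _ =>
    AddCircle.homeomorphAddCircle (2 * Real.pi) 1 Real.two_pi_pos.ne' one_ne_zero

theorem mFourier_toUnitAddTorus (k : Fin d → ℤ) (x : Torus d) :
    UnitAddTorus.mFourier k (toUnitAddTorus d x) = character k x := by
  simp only [UnitAddTorus.mFourier, ContinuousMap.coe_mk, character]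
  refine Finset.prod_congr rfl fun j _ => ?_
  induction hx : x j using QuotientAddGroup.induction_on with
  | H t =>
    have : (Real.pi : ℂ) ≠ 0 := by exact_mod_cast Real.pi_ne_zero
    simp only [toUnitAddTorus, Homeomorph.piCongrRight_apply, hx]
    rw [AddCircle.homeomorphAddCircle_apply_mk, fourier_coe_apply, fourier_coe_apply]
    congr 1
    push_cast
    field_simp

theorem span_characterMap_closure_eq_top :
    (Submodule.span ℂ (Set.range (characterMap (d := d)))).topologicalClosure = ⊤ := by
  let Φ : C(UnitAddTorus (Fin d), ℂ) →L[ℂ] C(Torus d, ℂ) :=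
    ⟨((toUnitAddTorus d).compStarAlgEquiv' ℂ ℂ : _ →ₗ[ℂ] _),
      ContinuousMap.continuous_precomp (toUnitAddTorus d : C(Torus d, UnitAddTorus (Fin d)))⟩
  have hrange : Set.range (characterMap (d := d)) = Φ '' Set.range UnitAddTorus.mFourier := by
    rw [← Set.range_comp]
    congr 1
    ext k x
    exact (mFourier_toUnitAddTorus k x).symm
  have hΦ : Function.Surjective Φ := ((toUnitAddTorus d).compStarAlgEquiv' ℂ ℂ).surjective
  have hmap := hΦ.denseRange.topologicalClosure_map_submodule
    UnitAddTorus.span_mFourier_closure_eq_top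
  rwa [Submodule.map_span, ContinuousLinearMap.coe_coe, ← hrange] at hmap

/-! ### The means as Fourier multiplier operators -/

/-- The weights of the generalized Bochner–Riesz means. -/
def weight (β δ : ℝ) (n : ℕ) (k : Fin d → ℤ) : ℝ :=
  (max (1 - eucl k ^ β / (n : ℝ) ^ β) 0) ^ δ

/-- The cube of lattice points with coordinates of modulus at most `n`. -/
def latticeCube (d n : ℕ) : Finset (Fin d → ℤ) :=
  Fintype.piFinset fun _ => Finset.Icc (-n : ℤ) n

theorem mem_latticeCube {n : ℕ} {k : Fin d → ℤ} : k ∈ latticeCube d n ↔ ∀ j, |k j| ≤ n := by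
  simp [latticeCube, abs_le]

theorem abs_le_eucl (k : Fin d → ℤ) (j : Fin d) : |(k j : ℝ)| ≤ eucl k :=
  Real.abs_le_sqrt (Finset.single_le_sum (f := fun j => (k j : ℝ) ^ 2)
    (fun _ _ => sq_nonneg _) (Finset.mem_univ j))

theorem weight_neg (β δ : ℝ) (n : ℕ) (k : Fin d → ℤ) : weight β δ n (-k) = weight β δ n k := by
  simp [weight, eucl]

section Weight

variable {β δ : ℝ} {n : ℕ}

theorem weight_eq_zero_of_notMem (hβ : 0 < β) (hδ : 0 < δ) (hn : 1 ≤ n) {k : Fin d → ℤ}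
    (hk : k ∉ latticeCube d n) : weight β δ n k = 0 := by
  obtain ⟨j, hj⟩ := not_forall.1 (mt mem_latticeCube.2 hk)
  have hnj : (n : ℝ) ≤ |(k j : ℝ)| := by exact_mod_cast (not_le.1 hj).le
  have hpow : (n : ℝ) ^ β ≤ eucl k ^ β :=
    Real.rpow_le_rpow n.cast_nonneg (hnj.trans (abs_le_eucl k j)) hβ.le
  have hone : 1 ≤ eucl k ^ β / (n : ℝ) ^ β := (one_le_div (by positivity)).2 hpow
  rw [weight, max_eq_right (by linarith), Real.zero_rpow hδ.ne']

theorem tendsto_weight (hβ : 0 < β) (k : Fin d → ℤ) :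
    Tendsto (fun n => weight β δ n k) atTop (𝓝 1) := by
  have hquot : Tendsto (fun n : ℕ => eucl k ^ β / (n : ℝ) ^ β) atTop (𝓝 0) :=
    tendsto_const_nhds.div_atTop ((tendsto_rpow_atTop hβ).comp tendsto_natCast_atTop_atTop)
  have hmax := ((tendsto_const_nhds (x := (1 : ℝ))).sub hquot).max
    (tendsto_const_nhds (x := (0 : ℝ)))
  simpa [weight] using hmax.rpow_const (p := δ) (Or.inl (by norm_num))

theorem kernel_eq_sum (hβ : 0 < β) (hδ : 0 < δ) (hn : 1 ≤ n) (x : Torus d) :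
    kernel d β δ n x = ∑ k ∈ latticeCube d n, (weight β δ n k : ℂ) * character (-k) x := by
  have hsum : ∑' k : Fin d → ℤ, (weight β δ n k : ℂ) * character (-k) x =
      ∑ k ∈ latticeCube d n, (weight β δ n k : ℂ) * character (-k) x :=
    tsum_eq_sum fun k hk => by
      rw [weight_eq_zero_of_notMem hβ hδ hn hk, Complex.ofReal_zero, zero_mul]
  rw [← hsum, ← (Equiv.neg _).tsum_eq]
  simp only [Equiv.neg_apply, weight_neg, neg_neg]
  rfl

end Weight

section Lp

variable (p : ℝ≥0∞) [hp : Fact (1 ≤ p)]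

/-- The Fourier coefficient of index `k`; it is `0` if `g` is not integrable. -/
def fourierCoeff (k : Fin d → ℤ) (g : Torus d → ℂ) : ℂ :=
  (((2 * Real.pi) ^ d : ℝ) : ℂ)⁻¹ * ∫ x, g x * character (-k) x

/-- The characters as elements of `L_p`. -/
def characterLp (k : Fin d → ℤ) : Lp ℂ p (volume : Measure (Torus d)) :=
  ContinuousMap.toLp p volume ℂ (characterMap k)

theorem coeFn_characterLp (k : Fin d → ℤ) : characterLp p k =ᵐ[volume] character k :=
  ContinuousMap.coeFn_toLp volume (characterMap k)

/-- The Fourier coefficient of index `k`, as a functional on `L_p`. -/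
def fourierCoeffLp (k : Fin d → ℤ) : Lp ℂ p (volume : Measure (Torus d)) →L[ℂ] ℂ :=
  haveI := ENNReal.HolderConjugate.inv_one_sub_inv' hp.out
  haveI : Fact (1 ≤ (1 - p⁻¹)⁻¹) := by simp [fact_iff]
  (((2 * Real.pi) ^ d : ℝ) : ℂ)⁻¹ •
    ((ContinuousLinearMap.mul ℂ ℂ).lpPairing volume p (1 - p⁻¹)⁻¹).flip
      (characterLp (1 - p⁻¹)⁻¹ (-k))

variable {p} in
theorem fourierCoeffLp_apply (k : Fin d → ℤ) {f : Lp ℂ p (volume : Measure (Torus d))}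
    {g : Torus d → ℂ} (hfg : f =ᵐ[volume] g) : fourierCoeffLp p k f = fourierCoeff k g := by
  have := ENNReal.HolderConjugate.inv_one_sub_inv' hp.out
  have : Fact (1 ≤ (1 - p⁻¹)⁻¹) := by simp [fact_iff]
  simp only [fourierCoeffLp, fourierCoeff, smul_apply, ContinuousLinearMap.flip_apply,
    ContinuousLinearMap.lpPairing_eq_integral, smul_eq_mul]
  congr 1
  refine integral_congr_ae ?_
  filter_upwards [coeFn_characterLp (1 - p⁻¹)⁻¹ (-k), hfg] with x hx hx'
  simp [hx, hx']

theorem fourierCoeffLp_characterLp (k l : Fin d → ℤ) :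
    fourierCoeffLp p k (characterLp p l) = if k = l then 1 else 0 := by
  have h2pi : (((2 * Real.pi) ^ d : ℝ) : ℂ) ≠ 0 := by exact_mod_cast (by positivity)
  rw [fourierCoeffLp_apply k (coeFn_characterLp p l), fourierCoeff]
  simp only [← character_add, integral_character, ← sub_eq_add_neg, sub_eq_zero, eq_comm (a := l)]
  split_ifs
  · exact inv_mul_cancel₀ h2pi
  · exact mul_zero _

/-- The operator with Fourier multiplier `m`, cut off to the finite set `s` of frequencies. -/
def multiplierOp (s : Finset (Fin d → ℤ)) (m : (Fin d → ℤ) → ℂ) :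
    Lp ℂ p (volume : Measure (Torus d)) →L[ℂ] Lp ℂ p (volume : Measure (Torus d)) :=
  ∑ k ∈ s, m k • (fourierCoeffLp p k).smulRight (characterLp p k)

theorem multiplierOp_apply (s : Finset (Fin d → ℤ)) (m : (Fin d → ℤ) → ℂ)
    (f : Lp ℂ p (volume : Measure (Torus d))) :
    multiplierOp p s m f = ContinuousMap.toLp p volume ℂ
      (∑ k ∈ s, (m k * fourierCoeffLp p k f) • characterMap k) := by
  simp only [multiplierOp, sum_apply, smul_apply, ContinuousLinearMap.smulRight_apply, smul_smul,
    map_sum, map_smul, characterLp]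

theorem multiplierOp_characterLp {s : Finset (Fin d → ℤ)} {m : (Fin d → ℤ) → ℂ}
    (hm : ∀ k ∉ s, m k = 0) (l : Fin d → ℤ) :
    multiplierOp p s m (characterLp p l) = m l • characterLp p l := by
  simp only [multiplierOp, sum_apply, smul_apply, ContinuousLinearMap.smulRight_apply,
    fourierCoeffLp_characterLp, ite_smul, one_smul, zero_smul, smul_ite, smul_zero,
    Finset.sum_ite_eq']
  split_ifs with hl
  · rfl
  · rw [hm l hl, zero_smul]

/-- The generalized Bochner–Riesz means as bounded operators on `L_p`. -/
def meanOp (d : ℕ) (β δ : ℝ) (n : ℕ) :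
    Lp ℂ p (volume : Measure (Torus d)) →L[ℂ] Lp ℂ p (volume : Measure (Torus d)) :=
  multiplierOp p (latticeCube d n) fun k => (weight β δ n k : ℂ)

variable {β δ : ℝ} {n : ℕ}

theorem meanOp_characterLp (hβ : 0 < β) (hδ : 0 < δ) (hn : 1 ≤ n) (k : Fin d → ℤ) :
    meanOp p d β δ n (characterLp p k) = (weight β δ n k : ℂ) • characterLp p k :=
  multiplierOp_characterLp p
    (fun k hk => by rw [weight_eq_zero_of_notMem hβ hδ hn hk, Complex.ofReal_zero]) k

theorem integral_comp_add_mul_character (f : Torus d → ℂ) (k : Fin d → ℤ) (x : Torus d) :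
    ∫ y, f (x + y) * character k y = (∫ y, f y * character k y) * character (-k) x := by
  rw [← integral_mul_const,
    ← integral_add_left_eq_self (fun y => f y * character k y * character (-k) x) x]
  refine integral_congr_ae (ae_of_all _ fun y => ?_)
  have hinv : character k x * character (-k) x = 1 := by
    rw [← character_add, add_neg_cancel, character_zero]
  simp only [character_add_right]
  linear_combination (-f (x + y) * character k y) * hinv

theorem mean_eq_sum (hβ : 0 < β) (hδ : 0 < δ) (hn : 1 ≤ n) {f : Torus d → ℝ}
    (hf : Integrable (fun x => (f x : ℂ)) volume) (x : Torus d) :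
    mean d β δ n f x = ∑ k ∈ latticeCube d n,
      (weight β δ n k : ℂ) * fourierCoeff k (fun y => (f y : ℂ)) * character k x := by
  unfold mean fourierCoeff
  simp_rw [kernel_eq_sum hβ hδ hn, Finset.mul_sum, mul_left_comm _ (weight β δ n _ : ℂ)]
  rw [integral_finsetSum, Finset.mul_sum]
  · refine Finset.sum_congr rfl fun k _ => ?_
    rw [integral_const_mul, integral_comp_add_mul_character (fun y => (f y : ℂ)), neg_neg]
    ring
  · intro k _
    exact ((hf.comp_add_left x).mul_bdd (c := 1) (continuous_character _).aestronglyMeasurable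
      (ae_of_all _ fun y => (norm_character _ y).le)).const_mul _

theorem mean_ae_eq (hβ : 0 < β) (hδ : 0 < δ) (hn : 1 ≤ n) {f : Torus d → ℝ}
    (hf : MemLp (fun x => (f x : ℂ)) p volume) :
    mean d β δ n f =ᵐ[volume] meanOp p d β δ n (hf.toLp _) := by
  rw [meanOp, multiplierOp_apply]
  refine EventuallyEq.trans (ae_of_all _ fun x => ?_) (ContinuousMap.coeFn_toLp volume _).symm
  rw [mean_eq_sum hβ hδ hn (hf.integrable hp.out)]
  simp [fourierCoeffLp_apply _ hf.coeFn_toLp]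

end Lp

/-! ### Convergence is equivalent to uniform boundedness of the multipliers -/

theorem norm_toLp {Y E 𝕜 : Type*} [TopologicalSpace Y] [CompactSpace Y] [MeasurableSpace Y]
    [BorelSpace Y] [NormedAddCommGroup E] [SecondCountableTopologyEither Y E]
    [NormedField 𝕜] [NormedSpace 𝕜 E] (μ : Measure Y) [IsFiniteMeasure μ] (p : ℝ≥0∞)
    [Fact (1 ≤ p)] (g : C(Y, E)) : ‖ContinuousMap.toLp p μ 𝕜 g‖ = (eLpNorm g p μ).toReal := by
  rw [Lp.norm_def, eLpNorm_congr_ae (ContinuousMap.coeFn_toLp μ g)]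

section Convergence

variable (p : ℝ≥0∞) [hp : Fact (1 ≤ p)]

/-- The closed span of the characters in `L_p`; for `p = ∞` it is the space of (classes of)
continuous functions. -/
def trigClosure (d : ℕ) : Submodule ℂ (Lp ℂ p (volume : Measure (Torus d))) :=
  (Submodule.span ℂ (Set.range (characterLp p))).topologicalClosure

theorem map_span_characterMap :
    (Submodule.span ℂ (Set.range (characterMap (d := d)))).map
      (ContinuousMap.toLp (E := ℂ) p (volume : Measure (Torus d)) ℂ).toLinearMap =
      Submodule.span ℂ (Set.range (characterLp p)) := by
  rw [Submodule.map_span, ← Set.range_comp]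
  rfl

theorem toLp_mem_trigClosure (h : C(Torus d, ℂ)) :
    ContinuousMap.toLp p (volume : Measure (Torus d)) ℂ h ∈ trigClosure p d := by
  have hmem : h ∈ (Submodule.span ℂ (Set.range (characterMap (d := d)))).topologicalClosure :=
    span_characterMap_closure_eq_top ▸ Submodule.mem_top
  rw [trigClosure, ← map_span_characterMap]
  exact image_closure_subset_closure_image (ContinuousLinearMap.continuous _)
    (Set.mem_image_of_mem (ContinuousMap.toLp p (volume : Measure (Torus d)) ℂ) hmem)

theorem trigClosure_eq_top (h : p ≠ ∞) : trigClosure p d = ⊤ := by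
  rw [trigClosure, ← map_span_characterMap]
  exact (ContinuousMap.toLp_denseRange ℂ (volume : Measure (Torus d)) ℂ
    h).topologicalClosure_map_submodule span_characterMap_closure_eq_top

theorem trigClosure_top_le_range_toLp :
    (trigClosure ∞ d : Set (Lp ℂ ∞ (volume : Measure (Torus d)))) ⊆
      Set.range (ContinuousMap.toLp ∞ volume ℂ) := by
  have hiso : Isometry (ContinuousMap.toLp (E := ℂ) ∞ (volume : Measure (Torus d)) ℂ) :=
    AddMonoidHomClass.isometry_of_norm _ (norm_toLp_top volume)
  refine closure_minimal ?_ hiso.isClosedEmbedding.isClosed_range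
  rw [← map_span_characterMap]
  rintro _ ⟨x, _, rfl⟩
  exact ⟨x, rfl⟩

variable {p}

theorem InLp.memLp_ofReal {f : Torus d → ℝ} (hf : InLp p f) :
    MemLp (fun x => (f x : ℂ)) p volume := by
  unfold InLp at hf
  split_ifs at hf with h
  · exact ContinuousMap.memLp volume ℂ (⟨fun x => (f x : ℂ), by fun_prop⟩ : C(Torus d, ℂ))
  · exact hf.ofReal

theorem InLp.toLp_mem_trigClosure {f : Torus d → ℝ} (hf : InLp p f) :
    hf.memLp_ofReal.toLp _ ∈ trigClosure p d := by
  by_cases h : p = ∞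
  · have hc : Continuous f := by simpa [InLp, h] using hf
    exact BochnerRiesz.toLp_mem_trigClosure p
      (⟨fun x => (f x : ℂ), by fun_prop⟩ : C(Torus d, ℂ))
  · exact trigClosure_eq_top (d := d) p h ▸ Submodule.mem_top

theorem exists_inLp_ae_eq {g : Lp ℂ p (volume : Measure (Torus d))} (hg : g ∈ trigClosure p d) :
    ∃ f : Torus d → ℂ, f =ᵐ[volume] g ∧ InLp p (fun x => (f x).re) ∧
      InLp p (fun x => (f x).im) := by
  by_cases h : p = ∞
  · subst h
    obtain ⟨f, rfl⟩ := trigClosure_top_le_range_toLp hg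
    refine ⟨f, (ContinuousMap.coeFn_toLp _ f).symm, ?_, ?_⟩ <;>
    · simp only [InLp, if_true]
      fun_prop
  · refine ⟨g, ae_eq_refl _, ?_, ?_⟩
    · simpa only [InLp, if_neg h] using! (Lp.memLp g).re
    · simpa only [InLp, if_neg h] using! (Lp.memLp g).im

theorem exists_toLp_add_smul_toLp {g : Lp ℂ p (volume : Measure (Torus d))}
    (hg : g ∈ trigClosure p d) :
    ∃ f₁ f₂ : Torus d → ℝ, ∃ (h₁ : InLp p f₁) (h₂ : InLp p f₂),
      g = h₁.memLp_ofReal.toLp _ + Complex.I • h₂.memLp_ofReal.toLp _ := by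
  obtain ⟨f, hfg, h₁, h₂⟩ := exists_inLp_ae_eq hg
  refine ⟨_, _, h₁, h₂, ?_⟩
  rw [← MemLp.toLp_const_smul, ← MemLp.toLp_add, ← Lp.toLp_coeFn g (Lp.memLp g),
    MemLp.toLp_eq_toLp_iff]
  refine hfg.symm.trans (ae_of_all _ fun x => ?_)
  simpa [mul_comm] using (Complex.re_add_im (f x)).symm

variable {β δ : ℝ}

theorem tendsto_eLpNorm_sub_mean_iff (hβ : 0 < β) (hδ : 0 < δ) {f : Torus d → ℝ}
    (hf : MemLp (fun x => (f x : ℂ)) p volume) :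
    Tendsto (fun n => eLpNorm (fun x => (f x : ℂ) - mean d β δ n f x) p volume) atTop (𝓝 0) ↔
      Tendsto (fun n => meanOp p d β δ n (hf.toLp _)) atTop (𝓝 (hf.toLp _)) := by
  rw [tendsto_iff_edist_tendsto_0]
  refine tendsto_congr' ?_
  filter_upwards [eventually_ge_atTop 1] with n hn
  rw [edist_comm, Lp.edist_def]
  refine eLpNorm_congr_ae ?_
  filter_upwards [mean_ae_eq p hβ hδ hn hf, hf.coeFn_toLp] with x hx hx'
  simp [hx, hx']

-- The indices are shifted because the weights of index `0` involve a division by `0 ^ β = 0`.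
theorem convergesInLp_mean_iff (hβ : 0 < β) (hδ : 0 < δ) :
    ConvergesInLp p (mean d β δ) ↔ ∃ C, ∀ n,
      MultiplierBound (characterLp p (d := d)) C (fun k => (weight β δ (n + 1) k : ℂ)) := by
  have hchar : ∀ n k, meanOp p d β δ (n + 1) (characterLp p k) =
      (weight β δ (n + 1) k : ℂ) • characterLp p k := fun n =>
    meanOp_characterLp p hβ hδ (Nat.le_add_left 1 n)
  constructor
  · refine fun h => exists_multiplierBound_of_tendsto hchar fun g hg => ⟨g, ?_⟩
    obtain ⟨f₁, f₂, h₁, h₂, rfl⟩ := exists_toLp_add_smul_toLp hg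
    simp only [map_add, map_smul]
    refine (tendsto_add_atTop_iff_nat (f := fun n => meanOp p d β δ n _ +
      Complex.I • meanOp p d β δ n _) 1).2 ?_
    exact ((tendsto_eLpNorm_sub_mean_iff hβ hδ _).1 (h f₁ h₁)).add
      (((tendsto_eLpNorm_sub_mean_iff hβ hδ _).1 (h f₂ h₂)).const_smul _)
  · rintro ⟨C, hC⟩ f hf
    rw [tendsto_eLpNorm_sub_mean_iff hβ hδ hf.memLp_ofReal, ← tendsto_add_atTop_iff_nat 1]
    refine tendsto_of_multiplierBound hchar hC (fun k => ?_) hf.toLp_mem_trigClosure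
    exact (tendsto_add_atTop_iff_nat (f := fun n => (weight β δ n k : ℂ)) 1).2
      (by exact_mod_cast (Complex.continuous_ofReal.tendsto _).comp (tendsto_weight hβ k))

variable (p)

theorem norm_sum_characterLp (s : Finset (Fin d → ℤ)) (c : (Fin d → ℤ) → ℂ) :
    ‖∑ k ∈ s, c k • characterLp p k‖ =
      (eLpNorm (fun x : Torus d => ∑ k ∈ s, c k * character k x) p volume).toReal := by
  simp only [characterLp, ← map_smul, ← map_sum]
  rw [norm_toLp]
  congr 2
  ext x
  simp

theorem multiplierBound_character (y : Torus d) :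
    MultiplierBound (characterLp p (d := d)) 1 (fun k => character k y) := by
  intro s c
  have hcont : Continuous fun x : Torus d => ∑ k ∈ s, c k * character k x :=
    continuous_finsetSum _ fun k _ => continuous_const.mul (continuous_character k)
  rw [one_mul, norm_sum_characterLp, norm_sum_characterLp,
    ← eLpNorm_comp_measurePreserving hcont.aestronglyMeasurable (measurePreserving_add_right _ y)]
  simp only [Function.comp_def, character_add_right, mul_left_comm, mul_comm, le_refl]

end Convergence

/-! ### The Bessel integral -/

section BesselIntegral

theorem hasDerivAt_integral_mul_comp_mul {φ g g' : ℝ → ℝ} {a b M : ℝ} (hφ : Continuous φ)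
    (hg : ∀ x, HasDerivAt g (g' x) x) (hg' : Continuous g') (hM : ∀ x, |g' x| ≤ M) (r : ℝ) :
    HasDerivAt (fun r => ∫ u in a..b, φ u * g (r * u)) (∫ u in a..b, φ u * u * g' (r * u)) r := by
  have hgc : Continuous g := continuous_iff_continuousAt.2 fun x => (hg x).continuousAt
  refine (intervalIntegral.hasDerivAt_integral_of_dominated_loc_of_deriv_le
    (F := fun r u => φ u * g (r * u)) (F' := fun r u => φ u * u * g' (r * u))
    (bound := fun u => |φ u * u| * M) (s := Set.univ) Filter.univ_mem
    (.of_forall fun x => (by fun_prop : Continuous _).aestronglyMeasurable)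
    ((by fun_prop : Continuous _).intervalIntegrable _ _)
    (by fun_prop : Continuous _).aestronglyMeasurable (ae_of_all _ fun u _ x _ => ?_)
    ((by fun_prop : Continuous _).intervalIntegrable _ _) (ae_of_all _ fun u _ x _ => ?_)).2
  · rw [norm_mul]
    exact mul_le_mul_of_nonneg_left (hM _) (norm_nonneg _)
  · exact (((hg _).comp x (hasDerivAt_mul_const u)).const_mul (φ u)).congr_deriv (by ring)

/-- `∫_{-1}^1 (1 - u²)^ν cos(ru) du`, a multiple of `r^{-ν-1/2} J_{ν+1/2}(r)`. -/
def besselIntegral (ν r : ℝ) : ℝ := ∫ u in (-1 : ℝ)..1, (1 - u ^ 2) ^ ν * Real.cos (r * u)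

/-- The derivative of `besselIntegral ν`. -/
def besselIntegralDeriv (ν r : ℝ) : ℝ :=
  -∫ u in (-1 : ℝ)..1, (1 - u ^ 2) ^ ν * u * Real.sin (r * u)

variable {ν : ℝ}

theorem continuous_one_sub_sq_rpow (hν : 0 ≤ ν) : Continuous fun u : ℝ => (1 - u ^ 2) ^ ν :=
  (by fun_prop : Continuous fun u : ℝ => 1 - u ^ 2).rpow_const fun _ => Or.inr hν

theorem hasDerivAt_besselIntegral (hν : 0 ≤ ν) (r : ℝ) :
    HasDerivAt (besselIntegral ν) (besselIntegralDeriv ν r) r := by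
  refine (hasDerivAt_integral_mul_comp_mul (continuous_one_sub_sq_rpow hν) Real.hasDerivAt_cos
    (by fun_prop) (M := 1) (fun x => ?_) r).congr_deriv ?_
  · rw [abs_neg]
    exact Real.abs_sin_le_one x
  · simp only [mul_neg, intervalIntegral.integral_neg, besselIntegralDeriv]

theorem continuous_besselIntegral (hν : 0 ≤ ν) : Continuous (besselIntegral ν) :=
  continuous_iff_continuousAt.2 fun r => (hasDerivAt_besselIntegral hν r).continuousAt

theorem besselIntegral_add_one (hν : 0 ≤ ν) (r : ℝ) : besselIntegral (ν + 1) r =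
    besselIntegral ν r - ∫ u in (-1 : ℝ)..1, (1 - u ^ 2) ^ ν * u * u * Real.cos (r * u) := by
  have := continuous_one_sub_sq_rpow hν
  rw [besselIntegral, besselIntegral, ← intervalIntegral.integral_sub
    ((by fun_prop : Continuous _).intervalIntegrable _ _)
    ((by fun_prop : Continuous _).intervalIntegrable _ _)]
  refine intervalIntegral.integral_congr fun u hu => ?_
  rw [Set.uIcc_of_le (by norm_num)] at hu
  have hu0 : 0 ≤ 1 - u ^ 2 := by nlinarith [hu.1, hu.2]
  rw [Real.rpow_add_one' hu0 (by linarith)]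
  ring

theorem mul_besselIntegral_add_one (hν : 0 ≤ ν) (r : ℝ) :
    r * besselIntegral (ν + 1) r = -(2 * (ν + 1) * besselIntegralDeriv ν r) := by
  have := continuous_one_sub_sq_rpow hν
  have := continuous_one_sub_sq_rpow (ν := ν + 1) (by linarith)
  have hderiv (u : ℝ) : HasDerivAt (fun u : ℝ => (1 - u ^ 2) ^ (ν + 1) * Real.sin (r * u))
      (r * ((1 - u ^ 2) ^ (ν + 1) * Real.cos (r * u)) -
        2 * (ν + 1) * ((1 - u ^ 2) ^ ν * u * Real.sin (r * u))) u := by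
    have hsq : HasDerivAt (fun u : ℝ => 1 - u ^ 2) (-(2 * u)) u := by
      simpa using (hasDerivAt_pow 2 u).const_sub 1
    have hpow := hsq.rpow_const (p := ν + 1) (Or.inr (by linarith))
    refine (hpow.mul (hasDerivAt_const_mul r).sin).congr_deriv ?_
    rw [add_sub_cancel_right]
    ring
  have hftc := intervalIntegral.integral_eq_sub_of_hasDerivAt (a := -1) (b := 1)
    (fun u _ => hderiv u) ((by fun_prop : Continuous _).intervalIntegrable _ _)
  rw [intervalIntegral.integral_sub ((by fun_prop : Continuous _).intervalIntegrable _ _)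
    ((by fun_prop : Continuous _).intervalIntegrable _ _), intervalIntegral.integral_const_mul,
    intervalIntegral.integral_const_mul] at hftc
  have hzero : (0 : ℝ) ^ (ν + 1) = 0 := Real.zero_rpow (by linarith)
  norm_num [hzero] at hftc
  rw [besselIntegralDeriv, mul_neg, neg_neg]
  exact sub_eq_zero.1 hftc

theorem hasDerivAt_besselIntegralDeriv (hν : 0 ≤ ν) {r : ℝ} (hr : r ≠ 0) :
    HasDerivAt (besselIntegralDeriv ν)
      (-besselIntegral ν r - 2 * (ν + 1) / r * besselIntegralDeriv ν r) r := by
  have := continuous_one_sub_sq_rpow hν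
  refine (hasDerivAt_integral_mul_comp_mul (φ := fun u => (1 - u ^ 2) ^ ν * u) (by fun_prop)
    Real.hasDerivAt_sin (by fun_prop) Real.abs_cos_le_one r).neg.congr_deriv ?_
  have hparts := mul_besselIntegral_add_one hν r
  rw [besselIntegral_add_one hν] at hparts
  generalize ∫ u in (-1 : ℝ)..1, (1 - u ^ 2) ^ ν * u * u * Real.cos (r * u) = I at hparts ⊢
  field_simp
  linarith

theorem abs_besselIntegral_le (hν : 0 ≤ ν) (r : ℝ) : |besselIntegral ν r| ≤ 2 := by
  have hbound : ∀ u ∈ Set.uIoc (-1 : ℝ) 1, ‖(1 - u ^ 2) ^ ν * Real.cos (r * u)‖ ≤ 1 := by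
    intro u hu
    rw [Set.uIoc_of_le (by norm_num)] at hu
    have hu0 : 0 ≤ 1 - u ^ 2 := by nlinarith [hu.1, hu.2]
    rw [norm_mul, Real.norm_of_nonneg (Real.rpow_nonneg hu0 _)]
    exact mul_le_one₀ (Real.rpow_le_one hu0 (by nlinarith) hν) (norm_nonneg _)
      (Real.abs_cos_le_one _)
  have := intervalIntegral.norm_integral_le_of_norm_le_const hbound
  norm_num at this
  exact this

theorem besselIntegral_one_pos (hν : 0 ≤ ν) : 0 < besselIntegral ν 1 := by
  have := continuous_one_sub_sq_rpow hν
  refine intervalIntegral.intervalIntegral_pos_of_pos_on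
    ((by fun_prop : Continuous _).intervalIntegrable _ _) (fun u hu => ?_) (by norm_num)
  refine mul_pos (Real.rpow_pos_of_pos (by nlinarith [hu.1, hu.2]) _) (Real.cos_pos_of_mem_Ioo ?_)
  have := Real.pi_gt_three
  constructor <;> linarith [hu.1, hu.2]

end BesselIntegral

/-! ### Energy estimates -/

/-- On `[1, ∞)` the function `w` has derivative `w'` and solves `w'' = (c / r² - 1) w`; with
`c = ν (ν + 1)` this is the equation of `r ↦ √r J_{ν + 1/2}(r)`. -/
structure IsBesselSolution (c : ℝ) (w w' : ℝ → ℝ) : Prop where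
  hasDerivAt : ∀ r, 1 ≤ r → HasDerivAt w (w' r) r
  hasDerivAt_deriv : ∀ r, 1 ≤ r → HasDerivAt w' ((c / r ^ 2 - 1) * w r) r

namespace IsBesselSolution

variable {w w' : ℝ → ℝ} {c : ℝ}

theorem hasDerivAt_energy_mul_exp (h : IsBesselSolution c w w') (k : ℝ) {r : ℝ} (hr : 1 ≤ r) :
    HasDerivAt (fun r => (w r ^ 2 + w' r ^ 2) * Real.exp (k / r))
      ((2 * c * (w r * w' r) - k * (w r ^ 2 + w' r ^ 2)) / r ^ 2 * Real.exp (k / r)) r := by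
  have hexp := ((hasDerivAt_inv (by linarith : r ≠ 0)).const_mul k).exp
  simp only [← div_eq_mul_inv] at hexp
  refine ((((h.hasDerivAt r hr).pow 2).add ((h.hasDerivAt_deriv r hr).pow 2)).mul
    hexp).congr_deriv ?_
  simp only [Pi.add_apply, Pi.pow_apply]
  ring

theorem energy_le (h : IsBesselSolution c w w') (hc : 0 ≤ c) {r : ℝ} (hr : 1 ≤ r) :
    w r ^ 2 + w' r ^ 2 ≤ (w 1 ^ 2 + w' 1 ^ 2) * Real.exp c := by
  have hanti : AntitoneOn (fun r => (w r ^ 2 + w' r ^ 2) * Real.exp (c / r)) (Set.Ici 1) := by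
    refine antitoneOn_of_hasDerivWithinAt_nonpos (convex_Ici 1)
      (fun r hr => (h.hasDerivAt_energy_mul_exp c hr).continuousAt.continuousWithinAt)
      (fun r hr => (h.hasDerivAt_energy_mul_exp c (interior_subset hr)).hasDerivWithinAt)
      fun r _ => ?_
    have hnonneg : 0 ≤ c * (w r - w' r) ^ 2 := by positivity
    exact mul_nonpos_of_nonpos_of_nonneg
      (div_nonpos_of_nonpos_of_nonneg (by linarith) (sq_nonneg r)) (Real.exp_pos _).le
  have hle := hanti (Set.mem_Ici.2 le_rfl) (Set.mem_Ici.2 hr) hr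
  simp only [div_one] at hle
  exact (le_mul_of_one_le_right (by positivity) (Real.one_le_exp (by positivity))).trans hle

theorem le_energy (h : IsBesselSolution c w w') (hc : 0 ≤ c) {r : ℝ} (hr : 1 ≤ r) :
    (w 1 ^ 2 + w' 1 ^ 2) * Real.exp (-c) ≤ w r ^ 2 + w' r ^ 2 := by
  have hmono : MonotoneOn (fun r => (w r ^ 2 + w' r ^ 2) * Real.exp (-c / r)) (Set.Ici 1) := by
    refine monotoneOn_of_hasDerivWithinAt_nonneg (convex_Ici 1)
      (fun r hr => (h.hasDerivAt_energy_mul_exp (-c) hr).continuousAt.continuousWithinAt)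
      (fun r hr => (h.hasDerivAt_energy_mul_exp (-c) (interior_subset hr)).hasDerivWithinAt)
      fun r _ => ?_
    have hnonneg : 0 ≤ c * (w r + w' r) ^ 2 := by positivity
    exact mul_nonneg (div_nonneg (by linarith) (sq_nonneg r)) (Real.exp_pos _).le
  have hle := hmono (Set.mem_Ici.2 le_rfl) (Set.mem_Ici.2 hr) hr
  simp only [div_one] at hle
  refine hle.trans (mul_le_of_le_one_right (by positivity) (Real.exp_le_one_iff.2 ?_))
  exact div_nonpos_of_nonpos_of_nonneg (neg_nonpos.2 hc) (by linarith)

theorem hasDerivAt_mul_deriv_sub_div (h : IsBesselSolution c w w') (b : ℝ) {r : ℝ} (hr : 1 ≤ r) :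
    HasDerivAt (fun r => (w r * w' r - b) / r)
      (w' r ^ 2 / r - w r ^ 2 / r + c * w r ^ 2 / r ^ 3 + (b - w r * w' r) / r ^ 2) r := by
  have hr0 : r ≠ 0 := by linarith
  refine ((((h.hasDerivAt r hr).mul (h.hasDerivAt_deriv r hr)).sub_const b).div
    (hasDerivAt_id r) hr0).congr_deriv ?_
  simp only [id, Pi.mul_apply]
  field_simp
  ring

theorem continuousOn (h : IsBesselSolution c w w') : ContinuousOn w (Set.Ici 1) :=
  fun r hr => (h.hasDerivAt r hr).continuousAt.continuousWithinAt

theorem continuousOn_deriv (h : IsBesselSolution c w w') : ContinuousOn w' (Set.Ici 1) :=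
  fun r hr => (h.hasDerivAt_deriv r hr).continuousAt.continuousWithinAt

/-- The derivative of `w w' / r` is `(w'² - w²) / r` up to integrable terms, so the energy is shared
equally between `w²` and `w'²` on average. -/
theorem log_le_integral_sq_div (h : IsBesselSolution c w w') (hc : 0 ≤ c) {a b : ℝ}
    (ha : ∀ r, 1 ≤ r → a ≤ w r ^ 2 + w' r ^ 2) (hb : ∀ r, 1 ≤ r → w r ^ 2 + w' r ^ 2 ≤ b)
    {A : ℝ} (hA : 1 ≤ A) :
    a / 2 * Real.log A - b ≤ ∫ r in (1 : ℝ)..A, w r ^ 2 / r := by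
  have hIcc : Set.uIcc 1 A = Set.Icc 1 A := Set.uIcc_of_le hA
  have hw := h.continuousOn.mono (hIcc ▸ Set.Icc_subset_Ici_self : Set.uIcc 1 A ⊆ _)
  have hw' := h.continuousOn_deriv.mono (hIcc ▸ Set.Icc_subset_Ici_self : Set.uIcc 1 A ⊆ _)
  have hne : ∀ r ∈ Set.uIcc 1 A, r ≠ 0 := fun r hr => by linarith [(hIcc ▸ hr).1]
  have hne_pow (m : ℕ) : ∀ r ∈ Set.uIcc 1 A, r ^ m ≠ 0 := fun r hr => pow_ne_zero m (hne r hr)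
  have hcross {r : ℝ} (hr : 1 ≤ r) : |w r * w' r| ≤ b / 2 := by
    have hbr := hb r hr
    exact abs_le.2 ⟨by nlinarith [sq_nonneg (w r + w' r)], by nlinarith [sq_nonneg (w r - w' r)]⟩
  have hderiv : IntervalIntegrable (fun r => w' r ^ 2 / r - w r ^ 2 / r + c * w r ^ 2 / r ^ 3 +
      (b / 2 - w r * w' r) / r ^ 2) volume 1 A :=
    ContinuousOn.intervalIntegrable (by fun_prop (disch := first | exact hne | exact hne_pow _))
  have hsq : IntervalIntegrable (fun r => w r ^ 2 / r) volume 1 A :=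
    ContinuousOn.intervalIntegrable (by fun_prop (disch := exact hne))
  have hinv : IntervalIntegrable (fun r : ℝ => a * r⁻¹) volume 1 A :=
    ContinuousOn.intervalIntegrable (by fun_prop (disch := exact hne))
  have hle := intervalIntegral.integral_mono_on hA hinv (hderiv.add (hsq.const_mul 2)) fun r hr =>
    by
    have hr0 : 0 < r := by linarith [hr.1]
    have henergy : a * r⁻¹ ≤ (w r ^ 2 + w' r ^ 2) / r :=
      div_le_div_of_nonneg_right (ha r hr.1) hr0.le
    have hpotential : 0 ≤ c * w r ^ 2 / r ^ 3 := by positivity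
    have hcorrection : 0 ≤ (b / 2 - w r * w' r) / r ^ 2 :=
      div_nonneg (sub_nonneg.2 ((le_abs_self _).trans (hcross hr.1))) (sq_nonneg r)
    rw [add_div] at henergy
    linarith
  rw [intervalIntegral.integral_add hderiv (hsq.const_mul 2),
    intervalIntegral.integral_eq_sub_of_hasDerivAt
      (fun r hr => h.hasDerivAt_mul_deriv_sub_div (b / 2) (hIcc ▸ hr).1) hderiv,
    intervalIntegral.integral_const_mul, intervalIntegral.integral_const_mul,
    integral_inv_of_pos one_pos (by linarith), div_one, div_one] at hle
  have hend : (w A * w' A - b / 2) / A ≤ 0 :=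
    div_nonpos_of_nonpos_of_nonneg (sub_nonpos.2 ((le_abs_self _).trans (hcross hA))) (by linarith)
  linarith [(abs_le.1 (hcross le_rfl)).1, (abs_nonneg _).trans (hcross le_rfl)]

end IsBesselSolution

section BesselIntegral

variable {ν : ℝ}

theorem isBesselSolution_rpow_mul_besselIntegral (hν : 0 ≤ ν) :
    IsBesselSolution (ν * (ν + 1)) (fun r => r ^ (ν + 1) * besselIntegral ν r) (fun r =>
      r ^ (ν + 1) * besselIntegralDeriv ν r + (ν + 1) * r ^ ν * besselIntegral ν r) := by
  constructor <;> intro r hr <;> have hr0 : r ≠ 0 := by linarith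
  · refine ((Real.hasDerivAt_rpow_const (p := ν + 1) (Or.inl hr0)).mul
      (hasDerivAt_besselIntegral hν r)).congr_deriv ?_
    rw [add_sub_cancel_right]
    ring
  · refine (((Real.hasDerivAt_rpow_const (p := ν + 1) (Or.inl hr0)).mul
      (hasDerivAt_besselIntegralDeriv hν hr0)).add
      (((Real.hasDerivAt_rpow_const (p := ν) (Or.inl hr0)).const_mul (ν + 1)).mul
        (hasDerivAt_besselIntegral hν r))).congr_deriv ?_
    rw [add_sub_cancel_right, Real.rpow_sub_one hr0, Real.rpow_add_one hr0]
    field_simp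
    ring

theorem exists_abs_rpow_mul_besselIntegral_le (hν : 0 ≤ ν) :
    ∃ C, ∀ r, 1 ≤ r → |r ^ (ν + 1) * besselIntegral ν r| ≤ C := by
  refine ⟨_, fun r hr => Real.abs_le_sqrt (le_trans ?_
    ((isBesselSolution_rpow_mul_besselIntegral hν).energy_le (by positivity) hr))⟩
  exact le_add_of_nonneg_right (sq_nonneg _)

theorem exists_abs_besselIntegral_le_one_add_rpow (hν : 0 ≤ ν) :
    ∃ C, ∀ r, 0 ≤ r → |besselIntegral ν r| ≤ C * (1 + r) ^ (-(ν + 1)) := by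
  obtain ⟨C, hC⟩ := exists_abs_rpow_mul_besselIntegral_le hν
  refine ⟨(|C| + 2) * 2 ^ (ν + 1), fun r hr => ?_⟩
  have hr1 : 0 < 1 + r := by positivity
  rw [Real.rpow_neg hr1.le, ← div_eq_mul_inv, le_div_iff₀ (by positivity)]
  rcases le_or_gt r 1 with h | h
  · have hpow : (1 + r) ^ (ν + 1) ≤ 2 ^ (ν + 1) :=
      Real.rpow_le_rpow hr1.le (by linarith) (by linarith)
    refine mul_le_mul ((abs_besselIntegral_le hν r).trans ?_) hpow (by positivity) (by positivity)
    linarith [abs_nonneg C]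
  · have hpow : (1 + r) ^ (ν + 1) ≤ 2 ^ (ν + 1) * r ^ (ν + 1) := by
      rw [← Real.mul_rpow (by norm_num) hr]
      exact Real.rpow_le_rpow hr1.le (by linarith) (by linarith)
    have hCr := hC r h.le
    rw [abs_mul, abs_of_nonneg (by positivity)] at hCr
    calc |besselIntegral ν r| * (1 + r) ^ (ν + 1)
        ≤ |besselIntegral ν r| * (2 ^ (ν + 1) * r ^ (ν + 1)) := by gcongr
      _ = r ^ (ν + 1) * |besselIntegral ν r| * 2 ^ (ν + 1) := by ring
      _ ≤ (|C| + 2) * 2 ^ (ν + 1) := by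
          gcongr
          linarith [le_abs_self C]

theorem exists_log_le_integral_besselIntegral (hν : 0 ≤ ν) :
    ∃ a C, 0 < a ∧ ∀ A, 1 ≤ A →
      a * Real.log A - C ≤ ∫ r in (1 : ℝ)..A, (r ^ (ν + 1) * besselIntegral ν r) ^ 2 / r := by
  have hsol := isBesselSolution_rpow_mul_besselIntegral hν
  have hc : 0 ≤ ν * (ν + 1) := by positivity
  refine ⟨_, _, ?_, fun A hA => hsol.log_le_integral_sq_div hc (fun r => hsol.le_energy hc)
    (fun r => hsol.energy_le hc) hA⟩
  have := besselIntegral_one_pos hν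
  simp only [Real.one_rpow, one_mul]
  positivity

end BesselIntegral

/-! ### The Riesz kernel -/

section RieszKernel

open scoped RealInnerProductSpace FourierTransform

variable {V : Type*} [NormedAddCommGroup V] {δ : ℝ}

/-- The symbol `(1 - |ξ|²)_+^δ` of the classical Bochner–Riesz means. -/
def rieszSymbol (δ : ℝ) (ξ : V) : ℝ := (max (1 - ‖ξ‖ ^ 2) 0) ^ δ

theorem rieszSymbol_nonneg (δ : ℝ) (ξ : V) : 0 ≤ rieszSymbol δ ξ :=
  Real.rpow_nonneg (le_max_right _ _) _

theorem rieszSymbol_le_one (hδ : 0 ≤ δ) (ξ : V) : rieszSymbol δ ξ ≤ 1 :=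
  Real.rpow_le_one (le_max_right _ _) (max_le (sub_le_self 1 (sq_nonneg _)) zero_le_one) hδ

theorem rieszSymbol_eq_zero (hδ : 0 < δ) {ξ : V} (hξ : 1 ≤ ‖ξ‖) : rieszSymbol δ ξ = 0 := by
  rw [rieszSymbol, max_eq_right (by nlinarith), Real.zero_rpow hδ.ne']

theorem continuous_rieszSymbol (hδ : 0 ≤ δ) : Continuous (rieszSymbol δ : V → ℝ) :=
  (by fun_prop : Continuous fun ξ : V => max (1 - ‖ξ‖ ^ 2) 0).rpow_const fun _ => Or.inr hδ

variable [InnerProductSpace ℝ V] [FiniteDimensional ℝ V]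

theorem hasCompactSupport_rieszSymbol (hδ : 0 < δ) : HasCompactSupport (rieszSymbol δ : V → ℝ) :=
  HasCompactSupport.intro (isCompact_closedBall 0 1) fun ξ hξ =>
    rieszSymbol_eq_zero hδ (by simpa using (lt_of_not_ge (by simpa using hξ) : 1 < ‖ξ‖).le)

variable [MeasurableSpace V] [BorelSpace V]

theorem integrable_rieszSymbol_mul (hδ : 0 < δ) {g : V → ℝ} (hg : Continuous g) :
    Integrable fun ξ => rieszSymbol δ ξ * g ξ :=
  ((continuous_rieszSymbol hδ.le).mul hg).integrable_of_hasCompactSupport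
    (hasCompactSupport_rieszSymbol hδ).mul_right

theorem integral_rieszSymbol_pos (hδ : 0 < δ) : 0 < ∫ ξ : V, rieszSymbol δ ξ := by
  refine (continuous_rieszSymbol hδ.le).integral_pos_of_hasCompactSupport_nonneg_nonzero
    (hasCompactSupport_rieszSymbol hδ) (rieszSymbol_nonneg δ) (x := 0) ?_
  simp [rieszSymbol]

theorem integral_max_sub_norm_sq_rpow (hδ : 0 < δ) (t : ℝ) :
    ∫ ξ : V, (max (t - ‖ξ‖ ^ 2) 0) ^ δ =
      (max t 0) ^ (δ + Module.finrank ℝ V / 2) * ∫ ξ : V, rieszSymbol δ ξ := by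
  rcases le_or_gt t 0 with ht | ht
  · rw [max_eq_right ht, Real.zero_rpow (by positivity), zero_mul]
    refine integral_eq_zero_of_ae (ae_of_all _ fun ξ => ?_)
    simp only [Pi.zero_apply]
    rw [max_eq_right (by nlinarith [norm_nonneg ξ]), Real.zero_rpow hδ.ne']
  · have hscale (ξ : V) : (max (t - ‖√t • ξ‖ ^ 2) 0) ^ δ = t ^ δ * rieszSymbol δ ξ := by
      rw [norm_smul, mul_pow, Real.norm_of_nonneg (Real.sqrt_nonneg t), Real.sq_sqrt ht.le,
        rieszSymbol, ← Real.mul_rpow ht.le (le_max_right _ _), mul_max_of_nonneg _ _ ht.le,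
        mul_zero, mul_sub, mul_one]
    have hdil := Measure.integral_comp_smul (volume : Measure V)
      (fun ξ => (max (t - ‖ξ‖ ^ 2) 0) ^ δ) √t
    have hsqrt : √t ^ Module.finrank ℝ V = t ^ (Module.finrank ℝ V / 2 : ℝ) := by
      rw [Real.sqrt_eq_rpow, ← Real.rpow_natCast, ← Real.rpow_mul ht.le, one_div_mul_eq_div]
    simp only [hscale, integral_const_mul, smul_eq_mul, hsqrt] at hdil
    rw [abs_of_pos (by positivity), inv_mul_eq_div, eq_div_iff (by positivity)] at hdil
    rw [← hdil, max_eq_left ht.le, Real.rpow_add ht]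
    ring

/-- The Fourier transform of `rieszSymbol δ`, with the phase `⟪ξ, y⟫` instead of `2π⟪ξ, y⟫`. -/
def rieszKernel (δ : ℝ) (y : V) : ℝ := ∫ ξ : V, rieszSymbol δ ξ * Real.cos ⟪ξ, y⟫

theorem rieszKernel_eq_of_norm_eq (δ : ℝ) {y z : V} (h : ‖y‖ = ‖z‖) :
    rieszKernel δ y = rieszKernel δ z := by
  have hA := Submodule.reflection_sub h
  set A := Submodule.reflection (ℝ ∙ (y - z))ᗮ
  rw [rieszKernel, rieszKernel, ← A.measurePreserving.integral_comp
    A.toHomeomorph.measurableEmbedding fun ξ => rieszSymbol δ ξ * Real.cos ⟪ξ, z⟫]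
  simp only [rieszSymbol, A.norm_map, ← hA, A.inner_map_map]

theorem fourier_rieszSymbol (hδ : 0 < δ) (y : V) :
    𝓕 (fun ξ : V => (rieszSymbol δ ξ : ℂ)) y = rieszKernel δ ((2 * Real.pi) • y) := by
  have hsin : ∫ ξ : V, rieszSymbol δ ξ * Real.sin ⟪ξ, (2 * Real.pi) • y⟫ = 0 := by
    have hodd := integral_neg_eq_self
      (fun ξ : V => rieszSymbol δ ξ * Real.sin ⟪ξ, (2 * Real.pi) • y⟫) volume
    simp only [rieszSymbol, norm_neg, inner_neg_left, Real.sin_neg, mul_neg, integral_neg] at hodd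
    simp only [rieszSymbol]
    linarith
  have hexp (ξ : V) :
      Complex.exp ((-2 * Real.pi * ⟪ξ, y⟫ : ℝ) * Complex.I) • (rieszSymbol δ ξ : ℂ) =
      ((rieszSymbol δ ξ * Real.cos ⟪ξ, (2 * Real.pi) • y⟫ : ℝ) : ℂ) -
        ((rieszSymbol δ ξ * Real.sin ⟪ξ, (2 * Real.pi) • y⟫ : ℝ) : ℂ) * Complex.I := by
    rw [Complex.exp_mul_I, inner_smul_right, ← Complex.ofReal_cos, ← Complex.ofReal_sin,
      neg_mul, neg_mul, Real.cos_neg, Real.sin_neg, smul_eq_mul]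
    push_cast
    ring
  rw [Real.fourier_eq', integral_congr_ae (ae_of_all _ hexp),
    integral_sub (integrable_rieszSymbol_mul hδ (by fun_prop)).ofReal
      ((integrable_rieszSymbol_mul hδ (by fun_prop)).ofReal.mul_const _),
    integral_mul_const, integral_complex_ofReal, integral_complex_ofReal, hsin]
  simp [rieszKernel]

theorem measurePreserving_toLp_insertNth : MeasurePreserving
    (fun z : ℝ × EuclideanSpace ℝ (Fin d) =>
      (WithLp.toLp 2 (Fin.insertNth 0 z.1 z.2.ofLp : Fin (d + 1) → ℝ) :
        EuclideanSpace ℝ (Fin (d + 1)))) (volume.prod volume) volume :=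
  (PiLp.volume_preserving_toLp (Fin (d + 1))).comp <|
    (volume_preserving_piFinSuccAbove (fun _ : Fin (d + 1) => ℝ) 0).symm.comp <|
      (MeasurePreserving.id volume).prod (PiLp.volume_preserving_ofLp (Fin d))

theorem rieszSymbol_toLp_insertNth (δ u : ℝ) (x : EuclideanSpace ℝ (Fin d)) :
    rieszSymbol δ (WithLp.toLp 2 (Fin.insertNth 0 u x.ofLp : Fin (d + 1) → ℝ) :
      EuclideanSpace ℝ (Fin (d + 1))) = (max (1 - u ^ 2 - ‖x‖ ^ 2) 0) ^ δ := by
  rw [rieszSymbol, EuclideanSpace.real_norm_sq_eq, EuclideanSpace.real_norm_sq_eq,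
    Fin.sum_univ_succ, sub_sub]
  simp

theorem integral_rieszSymbol_mul_cos (hδ : 0 < δ) (r : ℝ) :
    ∫ ξ : EuclideanSpace ℝ (Fin (d + 1)), rieszSymbol δ ξ * Real.cos (r * ξ 0) =
      (∫ ξ : EuclideanSpace ℝ (Fin d), rieszSymbol δ ξ) * besselIntegral (δ + d / 2) r := by
  have hmp := measurePreserving_toLp_insertNth (d := d)
  have hint : Integrable fun ξ : EuclideanSpace ℝ (Fin (d + 1)) =>
      rieszSymbol δ ξ * Real.cos (r * ξ 0) := integrable_rieszSymbol_mul hδ (by fun_prop)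
  have hslice := hmp.integrable_comp_of_integrable hint
  rw [← hmp.map_eq] at hint ⊢
  rw [integral_map hmp.measurable.aemeasurable hint.aestronglyMeasurable]
  simp only [Function.comp_def, rieszSymbol_toLp_insertNth,
    Fin.insertNth_apply_same] at hslice ⊢
  rw [integral_prod _ hslice]
  simp only [integral_mul_const, integral_max_sub_norm_sq_rpow hδ, finrank_euclideanSpace_fin]
  rw [besselIntegral, ← intervalIntegral.integral_const_mul,
    intervalIntegral.integral_of_le (by norm_num : (-1 : ℝ) ≤ 1),
    ← integral_indicator measurableSet_Ioc]
  refine integral_congr_ae (ae_of_all _ fun u => ?_)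
  by_cases hu : u ∈ Set.Ioc (-1 : ℝ) 1
  · simp only [Set.indicator_of_mem hu, max_eq_left (by nlinarith [hu.1, hu.2] : 0 ≤ 1 - u ^ 2)]
    ring
  · have hu1 : 1 - u ^ 2 ≤ 0 := by
      simp only [Set.mem_Ioc, not_and_or, not_lt, not_le] at hu
      rcases hu with h | h <;> nlinarith
    simp only [Set.indicator_of_notMem hu, max_eq_right hu1,
      Real.zero_rpow (by positivity : δ + d / 2 ≠ 0), zero_mul]

theorem rieszKernel_eq_besselIntegral (hδ : 0 < δ) (y : EuclideanSpace ℝ (Fin (d + 1))) :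
    rieszKernel δ y = (∫ ξ : EuclideanSpace ℝ (Fin d), rieszSymbol δ ξ) *
      besselIntegral (δ + d / 2) ‖y‖ := by
  rw [rieszKernel_eq_of_norm_eq δ (z := EuclideanSpace.single 0 ‖y‖) (by simp),
    ← integral_rieszSymbol_mul_cos hδ, rieszKernel]
  simp [EuclideanSpace.inner_single_right]

theorem integrable_rieszKernel (hd : (d : ℝ) / 2 < δ) :
    Integrable (rieszKernel δ : EuclideanSpace ℝ (Fin (d + 1)) → ℝ) := by
  have hδ : 0 < δ := (by positivity : (0 : ℝ) ≤ d / 2).trans_lt hd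
  have hν : 0 ≤ δ + (d : ℝ) / 2 := by positivity
  obtain ⟨C, hC⟩ := exists_abs_besselIntegral_le_one_add_rpow hν
  rw [funext (rieszKernel_eq_besselIntegral hδ)]
  have hdim : (Module.finrank ℝ (EuclideanSpace ℝ (Fin (d + 1))) : ℝ) < δ + d / 2 + 1 := by
    rw [finrank_euclideanSpace_fin]
    push_cast
    linarith
  refine Integrable.const_mul (((integrable_one_add_norm hdim).const_mul C).mono'
    ((continuous_besselIntegral hν).comp continuous_norm).aestronglyMeasurable
    (ae_of_all _ fun y => hC _ (norm_nonneg y))) _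

/-- The frequency `k ∈ ℤ^d` as a vector of the dual group `ℝ^d`. -/
def freq (k : Fin d → ℤ) : EuclideanSpace ℝ (Fin d) := WithLp.toLp 2 fun j => (k j : ℝ)

theorem norm_freq (k : Fin d → ℤ) : ‖freq k‖ = eucl k := by
  simp [EuclideanSpace.norm_eq, freq, eucl]

theorem multiplierBound_fourierInv (p : ℝ≥0∞) [Fact (1 ≤ p)] {K : EuclideanSpace ℝ (Fin d) → ℂ}
    (hK : Integrable K) (t : ℝ) :
    MultiplierBound (characterLp p) (∫ y, ‖K y‖) (fun k => 𝓕⁻ K (t • freq k)) := by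
  have hphase (k : Fin d → ℤ) (y : EuclideanSpace ℝ (Fin d)) :
      Complex.exp ((2 * Real.pi * ⟪y, t • freq k⟫ : ℝ) * Complex.I) =
        character k (toTorus ((2 * Real.pi * t) • y.ofLp)) := by
    rw [character_toTorus, mul_comm Complex.I]
    congr 3
    simp only [PiLp.inner_apply, freq, Finset.mul_sum]
    refine Finset.sum_congr rfl fun j _ => ?_
    simp
    ring
  rw [← mul_one (∫ y, ‖K y‖)]
  refine MultiplierBound.integral hK
    (g := fun y k => character k (toTorus ((2 * Real.pi * t) • y.ofLp)))
    (ae_of_all _ fun y => multiplierBound_character p _) (fun k => ?_) fun k => ?_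
  · refine hK.mul_bdd (c := 1) (Continuous.aestronglyMeasurable ?_)
      (ae_of_all _ fun y => (norm_character _ _).le)
    simp only [← hphase]
    fun_prop
  · simp only [Real.fourierInv_eq', hphase, smul_eq_mul, mul_comm (K _)]

/-- The dilated radial symbols `ξ ↦ φ (|ξ|² / ρ)` are multipliers of `L_p(𝕋^d)` uniformly
in `ρ > 0`. -/
def IsRadialMultiplier (d : ℕ) (p : ℝ≥0∞) [Fact (1 ≤ p)] (φ : ℝ → ℝ) : Prop :=
  ∃ C, 0 ≤ C ∧ ∀ ρ : ℝ, 0 < ρ →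
    MultiplierBound (characterLp p (d := d)) C fun k => (φ (eucl k ^ 2 / ρ) : ℂ)

theorem isRadialMultiplier_riesz (p : ℝ≥0∞) [Fact (1 ≤ p)] (hd : (d : ℝ) / 2 < δ) :
    IsRadialMultiplier (d + 1) p fun v => (max (1 - v) 0) ^ δ := by
  have hδ : 0 < δ := (by positivity : (0 : ℝ) ≤ d / 2).trans_lt hd
  set m : EuclideanSpace ℝ (Fin (d + 1)) → ℂ := fun ξ => (rieszSymbol δ ξ : ℂ) with hm
  have hcont : Continuous m := Complex.continuous_ofReal.comp (continuous_rieszSymbol hδ.le)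
  have hsupp : HasCompactSupport m :=
    (hasCompactSupport_rieszSymbol hδ).comp_left Complex.ofReal_zero
  have hfourier : Integrable (𝓕 m) := by
    rw [show 𝓕 m = _ from funext (fourier_rieszSymbol hδ)]
    exact ((integrable_rieszKernel hd).comp_smul Real.two_pi_pos.ne').ofReal
  refine ⟨∫ y, ‖𝓕 m y‖, integral_nonneg fun y => norm_nonneg _, fun ρ hρ => ?_⟩
  have hbound := multiplierBound_fourierInv p hfourier (√ρ)⁻¹
  rw [hcont.fourierInv_fourier_eq (hcont.integrable_of_hasCompactSupport hsupp) hfourier] at hbound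
  simpa only [hm, rieszSymbol, norm_smul, norm_inv, norm_freq,
    Real.norm_of_nonneg (Real.sqrt_nonneg ρ), inv_mul_eq_div, div_pow,
    Real.sq_sqrt hρ.le] using hbound

end RieszKernel

/-! ### Subordination to the Riesz multipliers -/

section Taylor

variable {F : ℕ → ℝ → ℝ} {v s : ℝ} {N : ℕ}

/-- The Taylor polynomial of `F 0` based at the variable point `s` and evaluated at `v`, where
`F j` plays the role of the `j`-th derivative of `F 0`. -/
def taylorSum (F : ℕ → ℝ → ℝ) (v : ℝ) (N : ℕ) (s : ℝ) : ℝ :=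
  ∑ j ∈ Finset.range (N + 1), (-1) ^ j / (j.factorial : ℝ) * ((s - v) ^ j * F j s)

theorem taylorSum_succ (F : ℕ → ℝ → ℝ) (v : ℝ) (N : ℕ) (s : ℝ) :
    taylorSum F v (N + 1) s = taylorSum F v N s +
      (-1) ^ (N + 1) / ((N + 1).factorial : ℝ) * ((s - v) ^ (N + 1) * F (N + 1) s) :=
  Finset.sum_range_succ _ _

theorem taylorSum_self (F : ℕ → ℝ → ℝ) (v : ℝ) (N : ℕ) : taylorSum F v N v = F 0 v := by
  induction N with
  | zero => simp [taylorSum]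
  | succ N ih => simp [taylorSum_succ, ih]

theorem hasDerivAt_taylorSum (hF : ∀ j, HasDerivAt (F j) (F (j + 1) s) s) (v : ℝ) (N : ℕ) :
    HasDerivAt (taylorSum F v N)
      ((-1) ^ N / (N.factorial : ℝ) * ((s - v) ^ N * F (N + 1) s)) s := by
  induction N with
  | zero =>
    have hzero : taylorSum F v 0 = F 0 := by ext; simp [taylorSum]
    simpa [hzero] using hF 0
  | succ N ih =>
    have hpow : HasDerivAt (fun s : ℝ => (s - v) ^ (N + 1)) ((N + 1 : ℕ) * (s - v) ^ N) s :=
      (((hasDerivAt_id s).sub_const v).pow (N + 1)).congr_deriv (by simp)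
    rw [funext (taylorSum_succ F v N)]
    refine (ih.add ((hpow.mul (hF (N + 1))).const_mul
      ((-1) ^ (N + 1) / ((N + 1).factorial : ℝ)))).congr_deriv ?_
    have hfac : (N.factorial : ℝ) ≠ 0 := by exact_mod_cast N.factorial_ne_zero
    have hN : (N : ℝ) + 1 ≠ 0 := by positivity
    rw [Nat.factorial_succ]
    push_cast
    field_simp
    ring

theorem tendsto_taylorSum_atTop (hF : ∀ j, ∀ᶠ s in atTop, F j s = 0) (v : ℝ) (N : ℕ) :
    Tendsto (taylorSum F v N) atTop (𝓝 0) := by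
  refine tendsto_const_nhds.congr' ?_
  filter_upwards [(Finset.eventually_all (Finset.range (N + 1))).2 fun j _ => hF j] with s hs
  exact (Finset.sum_eq_zero fun j hj => by rw [hs j hj, mul_zero, mul_zero]).symm

theorem sub_pow_mul_eq_truncated (hv : 0 ≤ v) (h : ℝ → ℝ) (hs : v < s) :
    (s - v) ^ N * h s = s ^ N * h s * (max (1 - v / s) 0) ^ N := by
  have hs0 : 0 < s := hv.trans_lt hs
  have hle : 0 ≤ 1 - v / s := by
    rw [sub_nonneg, div_le_one hs0]
    exact hs.le
  rw [max_eq_left hle, mul_right_comm, ← mul_pow, mul_sub, mul_one, mul_div_cancel₀ v hs0.ne']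

theorem truncated_mem_Icc (hv : 0 ≤ v) (hs : 0 ≤ s) : max (1 - v / s) 0 ∈ Set.Icc (0 : ℝ) 1 :=
  ⟨le_max_right _ _, max_le (sub_le_self 1 (div_nonneg hv hs)) zero_le_one⟩

theorem eq_integral_truncated_pow (hF : ∀ j, ∀ s > 0, HasDerivAt (F j) (F (j + 1) s) s)
    (hF0 : ∀ j, ∀ᶠ s in atTop, F j s = 0) (hv : 0 ≤ v)
    (hcont : ContinuousWithinAt (taylorSum F v N) (Set.Ici v) v)
    (hint : IntegrableOn (fun s => s ^ N * F (N + 1) s) (Set.Ioi 0)) (hN : N ≠ 0) :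
    F 0 v = ∫ s in Set.Ioi (0 : ℝ),
      (-1) ^ (N + 1) / (N.factorial : ℝ) * (s ^ N * F (N + 1) s) * (max (1 - v / s) 0) ^ N := by
  set c : ℝ := (-1) ^ N / (N.factorial : ℝ)
  have hsub : Set.Ioi v ⊆ Set.Ioi 0 := Set.Ioi_subset_Ioi hv
  have htrunc : IntegrableOn (fun s => s ^ N * F (N + 1) s * (max (1 - v / s) 0) ^ N)
      (Set.Ioi 0) := by
    refine hint.mul_bdd (c := 1) (by fun_prop : Measurable _).aestronglyMeasurable ?_
    filter_upwards [ae_restrict_mem measurableSet_Ioi] with s hs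
    obtain ⟨h0, h1⟩ := truncated_mem_Icc hv (le_of_lt hs)
    rw [norm_pow, Real.norm_of_nonneg h0]
    exact pow_le_one₀ h0 h1
  have hderiv : IntegrableOn (fun s => c * ((s - v) ^ N * F (N + 1) s)) (Set.Ioi v) :=
    ((htrunc.mono_set hsub).congr_fun (fun s hs => (sub_pow_mul_eq_truncated hv _ hs).symm)
      measurableSet_Ioi).const_mul c
  have hftc := integral_Ioi_of_hasDerivAt_of_tendsto hcont
    (fun s hs => hasDerivAt_taylorSum (fun j => hF j s (hv.trans_lt hs)) v N) hderiv
    (tendsto_taylorSum_atTop hF0 v N)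
  rw [taylorSum_self, zero_sub, integral_const_mul, setIntegral_congr_fun measurableSet_Ioi
    fun s hs => sub_pow_mul_eq_truncated hv (F (N + 1)) hs] at hftc
  have hzero : ∀ s ∈ Set.Ioi (0 : ℝ) \ Set.Ioi v,
      s ^ N * F (N + 1) s * (max (1 - v / s) 0) ^ N = 0 := by
    rintro s ⟨hs0, hsv⟩
    have hle : 1 - v / s ≤ 0 := by
      rw [sub_nonpos, one_le_div hs0]
      exact not_lt.1 hsv
    rw [max_eq_right hle, zero_pow hN, mul_zero]
  rw [← setIntegral_eq_of_subset_of_forall_sdiff_eq_zero measurableSet_Ioi hsub hzero] at hftc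
  simp only [mul_assoc, integral_const_mul] at hftc ⊢
  rw [pow_succ, mul_neg_one, neg_div, neg_mul, hftc, neg_neg]

end Taylor

section PowSymbol

open scoped ContDiff

variable {b R : ℝ} {G : ℝ → ℝ}

/-- The functions `Hⱼ` with `(d/ds)^{j+1} G(s^b) = s^{b-j-1} Hⱼ(s^b)`. -/
def powSymbol (b : ℝ) (G : ℝ → ℝ) : ℕ → ℝ → ℝ
  | 0 => fun w => b * deriv G w
  | j + 1 => fun w => (b - (j + 1)) * powSymbol b G j w + b * w * deriv (powSymbol b G j) w

/-- The `j`-th derivative of `s ↦ G(s^b)` on the half line. -/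
def powDeriv (b : ℝ) (G : ℝ → ℝ) : ℕ → ℝ → ℝ
  | 0 => fun s => G (s ^ b)
  | j + 1 => fun s => s ^ (b - (j + 1)) * powSymbol b G j (s ^ b)

theorem contDiff_powSymbol (hG : ContDiff ℝ ∞ G) (j : ℕ) : ContDiff ℝ ∞ (powSymbol b G j) := by
  induction j with
  | zero => exact contDiff_const.mul (contDiff_infty_iff_deriv.1 hG).2
  | succ j ih =>
    have := (contDiff_infty_iff_deriv.1 ih).2
    unfold powSymbol
    fun_prop

theorem deriv_eq_zero_of_eventuallyEq_zero {f : ℝ → ℝ} {w : ℝ} (hf : f =ᶠ[𝓝 w] 0) :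
    deriv f w = 0 := by
  rw [hf.deriv_eq]
  exact deriv_const w 0

theorem powSymbol_eq_zero (hR : ∀ w, R < w → G w = 0) (j : ℕ) :
    ∀ w, R < w → powSymbol b G j w = 0 := by
  have hderiv {f : ℝ → ℝ} (hf : ∀ w, R < w → f w = 0) : ∀ w, R < w → deriv f w = 0 := fun w hw =>
    deriv_eq_zero_of_eventuallyEq_zero (by filter_upwards [Ioi_mem_nhds hw] with x hx using hf x hx)
  induction j with
  | zero => intro w hw; simp [powSymbol, hderiv hR w hw]
  | succ j ih => intro w hw; simp [powSymbol, ih w hw, hderiv ih w hw]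

theorem hasDerivAt_powDeriv (hG : ContDiff ℝ ∞ G) (j : ℕ) {s : ℝ} (hs : 0 < s) :
    HasDerivAt (powDeriv b G j) (powDeriv b G (j + 1) s) s := by
  have hrpow : HasDerivAt (fun s : ℝ => s ^ b) (b * s ^ (b - 1)) s :=
    Real.hasDerivAt_rpow_const (Or.inl hs.ne')
  cases j with
  | zero =>
    have hcomp := ((hG.differentiable (by simp) (s ^ b)).hasDerivAt.comp s hrpow)
    refine hcomp.congr_deriv ?_
    simp only [powDeriv, powSymbol, CharP.cast_eq_zero, zero_add]
    ring
  | succ j =>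
    have hsymbol := ((contDiff_powSymbol (b := b) hG j).differentiable (by simp)
      (s ^ b)).hasDerivAt.comp s hrpow
    refine ((Real.hasDerivAt_rpow_const (p := b - (j + 1)) (Or.inl hs.ne')).mul
      hsymbol).congr_deriv ?_
    have hexp : s ^ (b - ((j + 1 : ℕ) + 1)) = s ^ (b - (j + 1) - 1) := by
      rw [Nat.cast_add_one, sub_sub _ (j + 1 : ℝ)]
    have hmul : s ^ (b - (j + 1)) * s ^ (b - 1) = s ^ (b - (j + 1) - 1) * s ^ b := by
      rw [← Real.rpow_add hs, ← Real.rpow_add hs]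
      ring_nf
    simp only [powDeriv, powSymbol, Function.comp_apply, hexp]
    linear_combination (b * deriv (powSymbol b G j) (s ^ b)) * hmul

theorem pow_mul_powDeriv (j : ℕ) {s : ℝ} (hs : 0 < s) :
    s ^ j * powDeriv b G (j + 1) s = s ^ (b - 1) * powSymbol b G j (s ^ b) := by
  rw [powDeriv, ← mul_assoc, ← Real.rpow_natCast, ← Real.rpow_add hs]
  ring_nf

theorem continuousWithinAt_taylorSum_powDeriv (hb : 0 < b) (hG : ContDiff ℝ ∞ G) {v : ℝ}
    (hv : 0 ≤ v) (N : ℕ) : ContinuousWithinAt (taylorSum (powDeriv b G) v N) (Set.Ici v) v := by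
  rcases hv.eq_or_lt with rfl | hv
  · have hpow : Continuous fun s : ℝ => s ^ b := Real.continuous_rpow_const hb.le
    have hterm (j : ℕ) {s : ℝ} (hs : 0 ≤ s) :
        s ^ (j + 1) * powDeriv b G (j + 1) s = s ^ b * powSymbol b G j (s ^ b) := by
      rcases hs.eq_or_lt with rfl | hs
      · simp [Real.zero_rpow hb.ne']
      · rw [pow_succ', mul_assoc, pow_mul_powDeriv j hs, ← mul_assoc, mul_comm s,
          ← Real.rpow_add_one hs.ne', sub_add_cancel]
    have hsum : ∀ s ∈ Set.Ici (0 : ℝ), taylorSum (powDeriv b G) 0 N s = G (s ^ b) +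
        ∑ j ∈ Finset.range N,
          (-1) ^ (j + 1) / ((j + 1).factorial : ℝ) * (s ^ b * powSymbol b G j (s ^ b)) := by
      intro s hs
      rw [taylorSum, Finset.sum_range_succ', add_comm]
      simp only [sub_zero, hterm _ hs]
      simp [powDeriv]
    have hcont : Continuous fun s : ℝ => G (s ^ b) + ∑ j ∈ Finset.range N,
        (-1) ^ (j + 1) / ((j + 1).factorial : ℝ) * (s ^ b * powSymbol b G j (s ^ b)) :=
      (hG.continuous.comp hpow).add <| continuous_finsetSum _ fun j _ =>
        (hpow.mul ((contDiff_powSymbol hG j).continuous.comp hpow)).const_mul _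
    exact hcont.continuousWithinAt.congr hsum (hsum 0 Set.self_mem_Ici)
  · exact (hasDerivAt_taylorSum (fun j => hasDerivAt_powDeriv hG j hv)
      v N).continuousAt.continuousWithinAt

theorem eventually_powDeriv_eq_zero (hb : 0 < b) (hR : ∀ w, R < w → G w = 0) (j : ℕ) :
    ∀ᶠ s in atTop, powDeriv b G j s = 0 := by
  filter_upwards [(tendsto_rpow_atTop hb).eventually_gt_atTop R] with s hs
  cases j with
  | zero => exact hR _ hs
  | succ j => simp [powDeriv, powSymbol_eq_zero hR j _ hs]

theorem integrableOn_pow_mul_powDeriv (hb : 0 < b) (hG : ContDiff ℝ ∞ G)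
    (hR : ∀ w, R < w → G w = 0) (N : ℕ) :
    IntegrableOn (fun s => s ^ N * powDeriv b G (N + 1) s) (Set.Ioi 0) := by
  have hcont : Continuous fun s : ℝ => powSymbol b G N (s ^ b) :=
    (contDiff_powSymbol hG N).continuous.comp (Real.continuous_rpow_const hb.le)
  refine IntegrableOn.congr_fun ?_ (fun s hs => (pow_mul_powDeriv N hs).symm) measurableSet_Ioi
  obtain ⟨A, hA⟩ := eventually_atTop.1 ((tendsto_rpow_atTop hb).eventually_gt_atTop R)
  set B := max A 1
  have hloc : IntegrableOn (fun s : ℝ => s ^ (b - 1) * powSymbol b G N (s ^ b)) (Set.Ioc 0 B) := by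
    obtain ⟨C, hC⟩ := (isCompact_Icc (a := 0) (b := B)).exists_bound_of_continuousOn
      hcont.continuousOn
    refine Integrable.mul_bdd (c := C) (intervalIntegral.intervalIntegrable_rpow' (by linarith)).1
      hcont.aestronglyMeasurable ?_
    filter_upwards [ae_restrict_mem measurableSet_Ioc] with s hs using hC s ⟨hs.1.le, hs.2⟩
  refine hloc.of_forall_sdiff_eq_zero measurableSet_Ioi fun s hs => ?_
  have hsB : B < s := not_le.1 fun h => hs.2 ⟨hs.1, h⟩
  rw [powSymbol_eq_zero hR N _ (hA s ((le_max_left _ _).trans hsB.le)), mul_zero]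

theorem comp_rpow_eq_integral_truncated_pow (hb : 0 < b) (hG : ContDiff ℝ ∞ G)
    (hR : ∀ w, R < w → G w = 0) {N : ℕ} (hN : N ≠ 0) {v : ℝ} (hv : 0 ≤ v) :
    G (v ^ b) = ∫ s in Set.Ioi (0 : ℝ),
      (-1) ^ (N + 1) / (N.factorial : ℝ) * (s ^ N * powDeriv b G (N + 1) s) *
        (max (1 - v / s) 0) ^ N :=
  eq_integral_truncated_pow (F := powDeriv b G) (fun j _ hs => hasDerivAt_powDeriv hG j hs)
    (eventually_powDeriv_eq_zero hb hR) hv (continuousWithinAt_taylorSum_powDeriv hb hG hv N)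
    (integrableOn_pow_mul_powDeriv hb hG hR N) hN

end PowSymbol

section RadialMultiplier

open scoped ContDiff

variable {p : ℝ≥0∞} [Fact (1 ≤ p)]

namespace IsRadialMultiplier

variable {φ ψ : ℝ → ℝ}

theorem mul (hφ : IsRadialMultiplier d p φ) (hψ : IsRadialMultiplier d p ψ) :
    IsRadialMultiplier d p fun v => φ v * ψ v := by
  obtain ⟨C₁, hC₁, hφ⟩ := hφ
  obtain ⟨C₂, hC₂, hψ⟩ := hψ
  exact ⟨C₁ * C₂, by positivity, fun ρ hρ => by simpa using (hφ ρ hρ).mul (hψ ρ hρ) hC₁⟩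

theorem add (hφ : IsRadialMultiplier d p φ) (hψ : IsRadialMultiplier d p ψ) :
    IsRadialMultiplier d p fun v => φ v + ψ v := by
  obtain ⟨C₁, hC₁, hφ⟩ := hφ
  obtain ⟨C₂, hC₂, hψ⟩ := hψ
  exact ⟨C₁ + C₂, by positivity, fun ρ hρ => by simpa using (hφ ρ hρ).add (hψ ρ hρ)⟩

theorem integral {f : ℝ → ℝ} (hf : IntegrableOn f (Set.Ioi 0))
    (hφ : IsRadialMultiplier d p φ) (hmeas : Measurable φ) {B : ℝ}
    (hbound : ∀ v, 0 ≤ v → |φ v| ≤ B) :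
    IsRadialMultiplier d p fun v => ∫ s in Set.Ioi (0 : ℝ), f s * φ (v / s) := by
  obtain ⟨C, hC, hφ⟩ := hφ
  refine ⟨(∫ s in Set.Ioi (0 : ℝ), ‖(f s : ℂ)‖) * C,
    mul_nonneg (integral_nonneg fun _ => norm_nonneg _) hC, fun ρ hρ => ?_⟩
  refine MultiplierBound.integral (f := fun s => (f s : ℂ))
    (g := fun s k => (φ (eucl k ^ 2 / (ρ * s)) : ℂ)) hf.ofReal ?_ (fun k => ?_) fun k => ?_
  · filter_upwards [ae_restrict_mem measurableSet_Ioi] with s hs using hφ (ρ * s) (mul_pos hρ hs)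
  · refine Integrable.mul_bdd (c := B) hf.ofReal
      (by fun_prop : Measurable _).aestronglyMeasurable ?_
    filter_upwards [ae_restrict_mem measurableSet_Ioi] with s hs
    rw [Complex.norm_real]
    exact hbound _ (div_nonneg (sq_nonneg _) (mul_pos hρ hs).le)
  · rw [← integral_complex_ofReal]
    simp only [div_div, Complex.ofReal_mul]

end IsRadialMultiplier

theorem isRadialMultiplier_comp_rpow {b R : ℝ} {G : ℝ → ℝ} (hb : 0 < b) (hG : ContDiff ℝ ∞ G)
    (hR : ∀ w, R < w → G w = 0) : IsRadialMultiplier (d + 1) p fun v => G (v ^ b) := by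
  have hd : (d : ℝ) / 2 < (d + 1 : ℕ) := by
    push_cast
    linarith [(Nat.cast_nonneg d : (0 : ℝ) ≤ d)]
  obtain ⟨C, hC, hbound⟩ := (isRadialMultiplier_riesz p hd).integral
    ((integrableOn_pow_mul_powDeriv hb hG hR (d + 1)).const_mul
      ((-1) ^ (d + 1 + 1) / ((d + 1).factorial : ℝ)))
    (by fun_prop) (B := 1) fun v hv => by
      rw [abs_of_nonneg (Real.rpow_nonneg (le_max_right _ _) _)]
      exact Real.rpow_le_one (le_max_right _ _) (max_le (sub_le_self 1 hv) zero_le_one)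
        (by positivity)
  refine ⟨C, hC, fun ρ hρ => ?_⟩
  convert hbound ρ hρ using 3 with k
  beta_reduce
  rw [comp_rpow_eq_integral_truncated_pow hb hG hR d.succ_ne_zero (by positivity)]
  simp only [Real.rpow_natCast]

end RadialMultiplier

/-! ### Comparison of the exponents -/

section Comparison

open scoped ContDiff

/-- A smooth cutoff function, equal to `1` on `(-∞, a]` and to `0` on `[a', ∞)` when `a < a'`. -/
def cutoff (a a' v : ℝ) : ℝ := 1 - Real.smoothTransition ((v - a) / (a' - a))

theorem contDiff_cutoff {a a' : ℝ} : ContDiff ℝ ∞ (cutoff a a') :=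
  contDiff_const.sub <| Real.smoothTransition.contDiff.comp <|
    (contDiff_id.sub contDiff_const).div_const _

theorem cutoff_eq_one {a a' v : ℝ} (h : a < a') (hv : v ≤ a) : cutoff a a' v = 1 := by
  rw [cutoff, Real.smoothTransition.zero_of_nonpos, sub_zero]
  exact div_nonpos_of_nonpos_of_nonneg (sub_nonpos.2 hv) (sub_pos.2 h).le

theorem cutoff_eq_zero {a a' v : ℝ} (h : a < a') (hv : a' ≤ v) : cutoff a a' v = 0 := by
  rw [cutoff, Real.smoothTransition.one_of_one_le, sub_self]
  rw [one_le_div (sub_pos.2 h)]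
  exact sub_le_sub_right hv a

/-- `(1 - w) ^ q` for `w ≤ a`, cut off smoothly before the singularity at `w = 1`. -/
def truncatedPow (a q w : ℝ) : ℝ := (1 - w) ^ q * cutoff a ((1 + a) / 2) w

theorem truncatedPow_of_le {a q w : ℝ} (ha : a < 1) (hw : w ≤ a) :
    truncatedPow a q w = (1 - w) ^ q := by
  rw [truncatedPow, cutoff_eq_one (by linarith) hw, mul_one]

theorem truncatedPow_eq_zero {a q w : ℝ} (ha : a < 1) (hw : (1 + a) / 2 < w) :
    truncatedPow a q w = 0 := by
  rw [truncatedPow, cutoff_eq_zero (by linarith) hw.le, mul_zero]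

theorem contDiff_truncatedPow {a : ℝ} (ha : a < 1) (q : ℝ) : ContDiff ℝ ∞ (truncatedPow a q) := by
  refine contDiff_iff_contDiffAt.2 fun w => ?_
  rcases lt_or_ge w 1 with hw | hw
  · have hpow : ContDiffAt ℝ ∞ (fun w : ℝ => (1 - w) ^ q) w :=
      (contDiffAt_const.sub contDiffAt_id).rpow_const_of_ne (sub_pos.2 hw).ne'
    exact hpow.mul contDiff_cutoff.contDiffAt
  · have hzero : truncatedPow a q =ᶠ[𝓝 w] fun _ => 0 := by
      filter_upwards [Ioi_mem_nhds (show (1 + a) / 2 < w by linarith)] with x hx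
      exact truncatedPow_eq_zero ha hx
    exact contDiffAt_const.congr_of_eventuallyEq hzero

/-- The quotient `(v ^ b - 1) / (v - 1)`, with value `b` at `v = 1`. -/
def powSlope (b : ℝ) : ℝ → ℝ := dslope (fun v : ℝ => v ^ b) 1

theorem powSlope_of_ne {b v : ℝ} (hv : v ≠ 1) : powSlope b v = (v ^ b - 1) / (v - 1) := by
  rw [powSlope, dslope_of_ne _ hv, slope_def_field, Real.one_rpow]

theorem powSlope_pos {b v : ℝ} (hb : 0 < b) (hv : 0 < v) : 0 < powSlope b v := by
  rcases lt_trichotomy v 1 with h | rfl | h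
  · rw [powSlope_of_ne h.ne]
    exact div_pos_of_neg_of_neg (sub_neg.2 (Real.rpow_lt_one hv.le h hb)) (sub_neg.2 h)
  · rw [powSlope, dslope_same, (Real.hasDerivAt_rpow_const (Or.inl one_ne_zero)).deriv]
    simpa using hb
  · rw [powSlope_of_ne h.ne']
    exact div_pos (sub_pos.2 (Real.one_lt_rpow h hb)) (sub_pos.2 h)

theorem contDiffAt_powSlope {b v : ℝ} (hv : 0 < v) : ContDiffAt ℝ ∞ (powSlope b) v := by
  rcases eq_or_ne v 1 with rfl | h
  · have hexp : AnalyticAt ℝ (fun v : ℝ => Real.exp (Real.log v * b)) 1 :=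
      ((analyticAt_id.log one_pos).mul analyticAt_const).rexp
    obtain ⟨q, hq⟩ : AnalyticAt ℝ (fun v : ℝ => v ^ b) 1 := by
      refine hexp.congr ?_
      filter_upwards [Ioi_mem_nhds (zero_lt_one' ℝ)] with x hx
      rw [Real.rpow_def_of_pos hx]
    exact AnalyticAt.contDiffAt ⟨_, hq.has_fpower_series_dslope_fslope⟩
  · have hquot : ContDiffAt ℝ ∞ (fun v : ℝ => (v ^ b - 1) / (v - 1)) v :=
      ((contDiffAt_id.rpow_const_of_ne hv.ne').sub contDiffAt_const).div
        (contDiffAt_id.sub contDiffAt_const) (sub_ne_zero.2 h)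
    refine hquot.congr_of_eventuallyEq ?_
    filter_upwards [isOpen_ne.mem_nhds h] with x hx using powSlope_of_ne hx

/-- `((1 - v ^ b₁) / (1 - v ^ b₂)) ^ δ` on `[1 / 2, 1)`, continued smoothly across `v = 1` and cut
off to the compact interval `[1 / 4, 2]`. -/
def slopeQuotient (b₁ b₂ δ v : ℝ) : ℝ :=
  (1 - cutoff (1 / 4) (1 / 2) v) * ((powSlope b₁ v / powSlope b₂ v) ^ δ * cutoff 1 2 v)

theorem contDiff_slopeQuotient {b₁ b₂ : ℝ} (hb₁ : 0 < b₁) (hb₂ : 0 < b₂) (δ : ℝ) :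
    ContDiff ℝ ∞ (slopeQuotient b₁ b₂ δ) := by
  refine contDiff_iff_contDiffAt.2 fun v => ?_
  rcases lt_or_ge 0 v with hv | hv
  · have hquot : ContDiffAt ℝ ∞ (fun v : ℝ => (powSlope b₁ v / powSlope b₂ v) ^ δ) v :=
      ((contDiffAt_powSlope hv).div (contDiffAt_powSlope hv)
        (powSlope_pos hb₂ hv).ne').rpow_const_of_ne
        (div_pos (powSlope_pos hb₁ hv) (powSlope_pos hb₂ hv)).ne'
    exact (contDiffAt_const.sub contDiff_cutoff.contDiffAt).mul
      (hquot.mul contDiff_cutoff.contDiffAt)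
  · have hzero : slopeQuotient b₁ b₂ δ =ᶠ[𝓝 v] fun _ => 0 := by
      filter_upwards [Iio_mem_nhds (show v < 1 / 4 by linarith)] with x hx
      rw [slopeQuotient, cutoff_eq_one (by norm_num) (le_of_lt hx), sub_self, zero_mul]
    exact contDiffAt_const.congr_of_eventuallyEq hzero

/-- A radial multiplier, in the variable `v = |k|² / n²`, carrying the weights of exponent `2 b₂`
to those of exponent `2 b₁`: the quotient `((1 - v ^ b₁) / (1 - v ^ b₂)) ^ δ`, split into a part
near `v = 0`, where it is a product of smooth functions of `v ^ b₁` and of `v ^ b₂`, and a part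
near `v = 1`, where it is smooth in `v`. -/
def comparison (b₁ b₂ δ v : ℝ) : ℝ :=
  cutoff (1 / 4) (1 / 2) v *
    (truncatedPow ((1 / 2) ^ b₁) δ (v ^ b₁) * truncatedPow ((1 / 2) ^ b₂) (-δ) (v ^ b₂)) +
    slopeQuotient b₁ b₂ δ v

theorem half_rpow_lt_one {b : ℝ} (hb : 0 < b) : (1 / 2 : ℝ) ^ b < 1 :=
  Real.rpow_lt_one (by norm_num) (by norm_num) hb

theorem comparison_eq {b₁ b₂ v : ℝ} (hb₁ : 0 < b₁) (hb₂ : 0 < b₂) (δ : ℝ) (hv : 0 ≤ v)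
    (hv1 : v < 1) : comparison b₁ b₂ δ v = (1 - v ^ b₁) ^ δ * ((1 - v ^ b₂) ^ δ)⁻¹ := by
  have hpos₁ : 0 < 1 - v ^ b₁ := sub_pos.2 (Real.rpow_lt_one hv hv1 hb₁)
  have hpos₂ : 0 < 1 - v ^ b₂ := sub_pos.2 (Real.rpow_lt_one hv hv1 hb₂)
  have hslope : powSlope b₁ v / powSlope b₂ v = (1 - v ^ b₁) / (1 - v ^ b₂) := by
    rw [powSlope_of_ne hv1.ne, powSlope_of_ne hv1.ne, div_div_div_cancel_right₀
      (sub_ne_zero.2 hv1.ne), ← neg_div_neg_eq, neg_sub, neg_sub]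
  have hquot : slopeQuotient b₁ b₂ δ v =
      (1 - cutoff (1 / 4) (1 / 2) v) * ((1 - v ^ b₁) ^ δ * ((1 - v ^ b₂) ^ δ)⁻¹) := by
    rw [slopeQuotient, hslope, Real.div_rpow hpos₁.le hpos₂.le,
      cutoff_eq_one one_lt_two hv1.le, mul_one, div_eq_mul_inv (_ ^ δ)]
  rw [comparison, hquot]
  rcases le_or_gt v (1 / 2) with h | h
  · rw [truncatedPow_of_le (half_rpow_lt_one hb₁) (Real.rpow_le_rpow hv h hb₁.le),
      truncatedPow_of_le (half_rpow_lt_one hb₂) (Real.rpow_le_rpow hv h hb₂.le),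
      Real.rpow_neg hpos₂.le]
    ring
  · rw [cutoff_eq_zero (by norm_num) h.le]
    ring

theorem comparison_mul {b₁ b₂ δ v : ℝ} (hb₁ : 0 < b₁) (hb₂ : 0 < b₂) (hδ : 0 < δ) (hv : 0 ≤ v) :
    comparison b₁ b₂ δ v * (max (1 - v ^ b₂) 0) ^ δ = (max (1 - v ^ b₁) 0) ^ δ := by
  rcases lt_or_ge v 1 with hv1 | hv1
  · have hpos (b : ℝ) (hb : 0 < b) : 0 < 1 - v ^ b := sub_pos.2 (Real.rpow_lt_one hv hv1 hb)
    rw [max_eq_left (hpos b₁ hb₁).le, max_eq_left (hpos b₂ hb₂).le, comparison_eq hb₁ hb₂ δ hv hv1,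
      inv_mul_cancel_right₀ (Real.rpow_pos_of_pos (hpos b₂ hb₂) δ).ne']
  · have hnonpos (b : ℝ) (hb : 0 < b) : 1 - v ^ b ≤ 0 := sub_nonpos.2 (Real.one_le_rpow hv1 hb.le)
    rw [max_eq_right (hnonpos b₁ hb₁), max_eq_right (hnonpos b₂ hb₂), Real.zero_rpow hδ.ne',
      mul_zero]

variable (p : ℝ≥0∞) [Fact (1 ≤ p)]

theorem isRadialMultiplier_of_contDiff {G : ℝ → ℝ} {R : ℝ} (hG : ContDiff ℝ ∞ G)
    (hR : ∀ w, R < w → G w = 0) : IsRadialMultiplier (d + 1) p G := by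
  simpa only [Real.rpow_one] using isRadialMultiplier_comp_rpow (d := d) (p := p) one_pos hG hR

theorem isRadialMultiplier_truncatedPow {b : ℝ} (hb : 0 < b) (q : ℝ) :
    IsRadialMultiplier (d + 1) p fun v => truncatedPow ((1 / 2) ^ b) q (v ^ b) :=
  isRadialMultiplier_comp_rpow hb (contDiff_truncatedPow (half_rpow_lt_one hb) q)
    fun _ hw => truncatedPow_eq_zero (half_rpow_lt_one hb) hw

theorem isRadialMultiplier_comparison {b₁ b₂ : ℝ} (hb₁ : 0 < b₁) (hb₂ : 0 < b₂) (δ : ℝ) :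
    IsRadialMultiplier (d + 1) p (comparison b₁ b₂ δ) := by
  have hcutoff : IsRadialMultiplier (d + 1) p (cutoff (1 / 4) (1 / 2)) :=
    isRadialMultiplier_of_contDiff p contDiff_cutoff
      fun w hw => cutoff_eq_zero (by norm_num) hw.le
  have hquot : IsRadialMultiplier (d + 1) p (slopeQuotient b₁ b₂ δ) :=
    isRadialMultiplier_of_contDiff p (contDiff_slopeQuotient hb₁ hb₂ δ) (R := 2) fun w hw => by
      rw [slopeQuotient, cutoff_eq_zero one_lt_two hw.le, mul_zero, mul_zero]
  exact (hcutoff.mul ((isRadialMultiplier_truncatedPow p hb₁ δ).mul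
    (isRadialMultiplier_truncatedPow p hb₂ (-δ)))).add hquot

end Comparison

section Convergence

variable (p : ℝ≥0∞) [Fact (1 ≤ p)] {β β' δ : ℝ}

theorem weight_eq (β δ : ℝ) (n : ℕ) (k : Fin d → ℤ) :
    weight β δ n k = (max (1 - (eucl k ^ 2 / (n : ℝ) ^ 2) ^ (β / 2)) 0) ^ δ := by
  have hsq {x : ℝ} (hx : 0 ≤ x) : (x ^ 2) ^ (β / 2) = x ^ β := by
    rw [← Real.rpow_natCast_mul hx]
    ring_nf
  rw [weight, Real.div_rpow (by positivity) (by positivity),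
    hsq (show 0 ≤ eucl k from Real.sqrt_nonneg _), hsq n.cast_nonneg]

theorem ConvergesInLp.of_exponent (hβ : 0 < β) (hβ' : 0 < β') (hδ : 0 < δ)
    (h : ConvergesInLp p (mean (d + 1) β' δ)) : ConvergesInLp p (mean (d + 1) β δ) := by
  rw [convergesInLp_mean_iff hβ' hδ] at h
  rw [convergesInLp_mean_iff hβ hδ]
  obtain ⟨C, hC⟩ := h
  obtain ⟨C', hC', hcomp⟩ :=
    isRadialMultiplier_comparison (d := d) p (half_pos hβ) (half_pos hβ') δ
  refine ⟨C' * C, fun n => ?_⟩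
  convert (hcomp (((n + 1 : ℕ) : ℝ) ^ 2) (by positivity)).mul (hC n) hC' using 2 with k
  rw [weight_eq β, weight_eq β', ← Complex.ofReal_mul,
    comparison_mul (half_pos hβ) (half_pos hβ') hδ (by positivity)]

theorem convergesInLp_of_critical_lt (hβ : 0 < β) (hd : (d : ℝ) / 2 < δ) :
    ConvergesInLp p (mean (d + 1) β δ) := by
  have hδ : 0 < δ := (by positivity : (0 : ℝ) ≤ d / 2).trans_lt hd
  refine ConvergesInLp.of_exponent p hβ two_pos hδ ?_
  rw [convergesInLp_mean_iff two_pos hδ]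
  obtain ⟨C, -, hC⟩ := isRadialMultiplier_riesz p hd
  refine ⟨C, fun n => ?_⟩
  convert hC (((n + 1 : ℕ) : ℝ) ^ 2) (by positivity) using 3 with k
  simp [weight_eq 2 δ]

end Convergence

/-! ### De la Vallée Poussin kernels -/

theorem card_latticeCube (d n : ℕ) : (latticeCube d n).card = (2 * n + 1) ^ d := by
  simp only [latticeCube, Fintype.card_piFinset, Int.card_Icc, Finset.prod_const, Finset.card_univ,
    Fintype.card_fin]
  congr 1
  lia

theorem neg_mem_latticeCube {n : ℕ} {k : Fin d → ℤ} :
    -k ∈ latticeCube d n ↔ k ∈ latticeCube d n := by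
  simp [mem_latticeCube]

theorem sum_latticeCube_neg {M : Type*} [AddCommMonoid M] (n : ℕ) (f : (Fin d → ℤ) → M) :
    ∑ k ∈ latticeCube d n, f (-k) = ∑ k ∈ latticeCube d n, f k :=
  Finset.sum_equiv (Equiv.neg _) (fun k => by simpa using neg_mem_latticeCube.symm) fun _ _ => rfl

section Continuous

variable {E : Type*} [NormedAddCommGroup E] {f : Torus d → E}

theorem integrable_of_continuous (hf : Continuous f) : Integrable f volume :=
  hf.integrable_of_hasCompactSupport (HasCompactSupport.of_compactSpace f)

theorem memLp_of_continuous (hf : Continuous f) (q : ℝ≥0∞) : MemLp f q volume :=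
  hf.memLp_of_hasCompactSupport (HasCompactSupport.of_compactSpace f)

end Continuous

theorem integral_sum_sum_character {ι : Type*} {s : Finset ι} {t : Finset (Fin d → ℤ)}
    {φ : ι → Fin d → ℤ} (h : ∀ b ∈ s, -φ b ∈ t) :
    ∫ x : Torus d, ∑ b ∈ s, ∑ a ∈ t, character (a + φ b) x =
      s.card * (((2 * Real.pi) ^ d : ℝ) : ℂ) := by
  have hint : ∀ k : Fin d → ℤ, Integrable (character k) (volume : Measure (Torus d)) :=
    fun k => integrable_of_continuous (continuous_character k)
  have hinner : ∀ b ∈ s, ∫ x : Torus d, ∑ a ∈ t, character (a + φ b) x =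
      (((2 * Real.pi) ^ d : ℝ) : ℂ) := by
    intro b hb
    rw [integral_finsetSum _ fun a _ => hint _]
    simp only [integral_character, add_eq_zero_iff_eq_neg, Finset.sum_ite_eq', if_pos (h b hb)]
  rw [integral_finsetSum _ fun b _ => integrable_finsetSum _ fun a _ => hint _,
    Finset.sum_congr rfl hinner, Finset.sum_const, nsmul_eq_mul]

/-- The cubic Dirichlet kernel. -/
def dirichlet (d n : ℕ) (x : Torus d) : ℂ := ∑ k ∈ latticeCube d n, character k x

theorem continuous_dirichlet (n : ℕ) : Continuous (dirichlet d n) :=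
  continuous_finsetSum _ fun k _ => continuous_character k

theorem norm_dirichlet_le (n : ℕ) (x : Torus d) : ‖dirichlet d n x‖ ≤ (2 * n + 1) ^ d := by
  refine (norm_sum_le _ _).trans ?_
  simp [norm_character, card_latticeCube]

theorem integral_norm_sq_dirichlet (n : ℕ) :
    ∫ x, ‖dirichlet d n x‖ ^ 2 = (2 * n + 1) ^ d * (2 * Real.pi) ^ d := by
  have hexpand : ∀ x : Torus d, ((‖dirichlet d n x‖ ^ 2 : ℝ) : ℂ) =
      ∑ b ∈ latticeCube d n, ∑ a ∈ latticeCube d n, character (a + -b) x := by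
    intro x
    rw [Complex.ofReal_pow, ← Complex.mul_conj']
    simp only [dirichlet, character_add, character_neg, map_sum, ← Finset.sum_mul,
      ← Finset.mul_sum]
  have hint : ((∫ x, ‖dirichlet d n x‖ ^ 2 : ℝ) : ℂ) = (2 * n + 1) ^ d * (2 * Real.pi) ^ d := by
    rw [← integral_complex_ofReal]
    simp only [hexpand]
    rw [integral_sum_sum_character (by simp), card_latticeCube]
    push_cast
    rfl
  exact_mod_cast hint

/-- A de la Vallée Poussin kernel: its Fourier coefficients are `1` on the cube of size `n`, while
its `L₁` norm is bounded independently of `n`. -/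
def vallee (d n : ℕ) (x : Torus d) : ℂ :=
  ((2 * n + 1 : ℂ) ^ d)⁻¹ * (dirichlet d (2 * n) x * dirichlet d n x)

theorem continuous_vallee (n : ℕ) : Continuous (vallee d n) :=
  continuous_const.mul ((continuous_dirichlet _).mul (continuous_dirichlet _))

theorem fourierCoeff_vallee {n : ℕ} {k : Fin d → ℤ} (hk : k ∈ latticeCube d n) :
    fourierCoeff k (vallee d n) = 1 := by
  have hexpand : ∀ x : Torus d, vallee d n x * character (-k) x = ((2 * n + 1 : ℂ) ^ d)⁻¹ *
      ∑ b ∈ latticeCube d n, ∑ a ∈ latticeCube d (2 * n), character (a + (b + -k)) x := by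
    intro x
    simp only [vallee, dirichlet, character_add, ← Finset.sum_mul, ← Finset.mul_sum, mul_assoc]
  have hmem : ∀ b ∈ latticeCube d n, -(b + -k) ∈ latticeCube d (2 * n) := by
    intro b hb
    rw [mem_latticeCube] at *
    intro j
    have hkj := abs_le.1 (hk j)
    have hbj := abs_le.1 (hb j)
    rw [abs_le, Pi.neg_apply, Pi.add_apply, Pi.neg_apply]
    push_cast
    constructor <;> lia
  have hcard : (2 * n + 1 : ℂ) ^ d ≠ 0 := pow_ne_zero _ (by exact_mod_cast (2 * n).succ_ne_zero)
  have hvol : (((2 * Real.pi) ^ d : ℝ) : ℂ) ≠ 0 := by exact_mod_cast (by positivity)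
  simp only [fourierCoeff, hexpand]
  rw [integral_const_mul, integral_sum_sum_character hmem, card_latticeCube]
  push_cast at hvol ⊢
  field_simp

theorem norm_vallee (n : ℕ) (x : Torus d) :
    ‖vallee d n x‖ = ((2 * n + 1 : ℝ) ^ d)⁻¹ * (‖dirichlet d (2 * n) x‖ * ‖dirichlet d n x‖) := by
  have hcast : (2 * n + 1 : ℂ) = (2 * n + 1 : ℕ) := by push_cast; rfl
  rw [vallee, norm_mul, norm_mul, norm_inv, norm_pow, hcast, Complex.norm_natCast]
  push_cast
  rfl

theorem norm_vallee_le (n : ℕ) (x : Torus d) : ‖vallee d n x‖ ≤ (4 * n + 1) ^ d := by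
  rw [norm_vallee, inv_mul_le_iff₀ (by positivity), mul_comm]
  have hbig : ‖dirichlet d (2 * n) x‖ ≤ (4 * n + 1) ^ d :=
    (norm_dirichlet_le (2 * n) x).trans_eq (by push_cast; ring)
  exact mul_le_mul (norm_dirichlet_le n x) hbig (norm_nonneg _) (by positivity)

theorem integral_norm_vallee_le (n : ℕ) : ∫ x, ‖vallee d n x‖ ≤ (4 * Real.pi) ^ d := by
  have hint : ∀ m, Integrable (fun x => ‖dirichlet d m x‖ ^ 2) volume :=
    fun m => integrable_of_continuous ((continuous_dirichlet m).norm.pow 2)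
  have hamgm : ∫ x, ‖vallee d n x‖ ≤ ∫ x, ((2 * n + 1 : ℝ) ^ d)⁻¹ *
      ((‖dirichlet d (2 * n) x‖ ^ 2 + ‖dirichlet d n x‖ ^ 2) / 2) := by
    refine integral_mono (integrable_of_continuous (continuous_vallee n).norm)
      ((((hint _).add (hint _)).div_const 2).const_mul _) fun x => ?_
    simp only [norm_vallee]
    gcongr
    linarith [two_mul_le_add_sq ‖dirichlet d (2 * n) x‖ ‖dirichlet d n x‖]
  refine hamgm.trans ?_
  rw [integral_const_mul, integral_div, integral_add (hint _) (hint _),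
    integral_norm_sq_dirichlet, integral_norm_sq_dirichlet, inv_mul_le_iff₀ (by positivity)]
  push_cast
  have hdouble : (2 * (2 * n) + 1 : ℝ) ^ d ≤ 2 ^ d * (2 * n + 1) ^ d := by
    rw [← mul_pow]
    gcongr
    linarith
  have hsingle : (2 * n + 1 : ℝ) ^ d ≤ 2 ^ d * (2 * n + 1) ^ d :=
    le_mul_of_one_le_left (by positivity) (one_le_pow₀ (by norm_num))
  have hsplit : (4 * Real.pi) ^ d = 2 ^ d * (2 * Real.pi) ^ d := by
    rw [← mul_pow]
    ring
  have : 0 < (2 * Real.pi) ^ d := by positivity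
  rw [hsplit]
  nlinarith

theorem toReal_eLpNorm_le_of_ae_bound {α E : Type*} [MeasurableSpace α] {μ : Measure α}
    [NormedAddCommGroup E] {f : α → E} (hf : Integrable f μ) {M : ℝ} (hM₀ : 0 ≤ M)
    (hM : ∀ᵐ x ∂μ, ‖f x‖ ≤ M) {q : ℝ≥0∞} (hq : 1 ≤ q) :
    (eLpNorm f q μ).toReal ≤ M ^ (1 - (q⁻¹).toReal) * (∫ x, ‖f x‖ ∂μ) ^ (q⁻¹).toReal := by
  rcases eq_or_ne q ∞ with rfl | hq_top
  · rw [eLpNorm_exponent_top]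
    simpa using ENNReal.toReal_le_of_le_ofReal hM₀ (eLpNormEssSup_le_of_ae_bound hM)
  have hq₀ : q ≠ 0 := (zero_lt_one.trans_le hq).ne'
  rw [toReal_eLpNorm hf.1, lpNorm_eq_integral_norm_rpow_toReal hq₀ hq_top hf.1, ENNReal.toReal_inv]
  set r := q.toReal
  have hr : 1 ≤ r := ENNReal.toReal_mono hq_top hq
  have hint : ∫ x, ‖f x‖ ^ r ∂μ ≤ M ^ (r - 1) * ∫ x, ‖f x‖ ∂μ := by
    rw [← integral_const_mul]
    refine integral_mono_of_nonneg (ae_of_all _ fun x => by positivity) (hf.norm.const_mul _) ?_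
    filter_upwards [hM] with x hx
    calc ‖f x‖ ^ r = ‖f x‖ ^ (r - 1) * ‖f x‖ := by
          rw [← Real.rpow_add_one' (norm_nonneg _) (by linarith), sub_add_cancel]
      _ ≤ M ^ (r - 1) * ‖f x‖ := by gcongr
  calc (∫ x, ‖f x‖ ^ r ∂μ) ^ r⁻¹ ≤ (M ^ (r - 1) * ∫ x, ‖f x‖ ∂μ) ^ r⁻¹ := by gcongr
    _ = M ^ (1 - r⁻¹) * (∫ x, ‖f x‖ ∂μ) ^ r⁻¹ := by
        rw [Real.mul_rpow (by positivity) (by positivity), ← Real.rpow_mul hM₀]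
        congr 2
        field_simp

theorem eLpNorm_vallee_le {q : ℝ≥0∞} (hq : 1 ≤ q) (n : ℕ) :
    (eLpNorm (vallee d n) q volume).toReal ≤
      (4 * Real.pi) ^ d * ((4 * n + 1 : ℝ) ^ d) ^ (1 - (q⁻¹).toReal) := by
  refine (toReal_eLpNorm_le_of_ae_bound (integrable_of_continuous (continuous_vallee n))
    (by positivity) (ae_of_all _ (norm_vallee_le n)) hq).trans ?_
  rw [mul_comm]
  gcongr
  calc (∫ x, ‖vallee d n x‖) ^ (q⁻¹).toReal ≤ ((4 * Real.pi) ^ d) ^ (q⁻¹).toReal :=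
        Real.rpow_le_rpow (integral_nonneg fun x => norm_nonneg _) (integral_norm_vallee_le n)
          ENNReal.toReal_nonneg
    _ ≤ ((4 * Real.pi) ^ d) ^ (1 : ℝ) := by
        gcongr
        · exact one_le_pow₀ (by linarith [Real.pi_gt_three])
        · exact ENNReal.toReal_mono ENNReal.one_ne_top (ENNReal.inv_le_one.2 hq)
    _ = (4 * Real.pi) ^ d := Real.rpow_one _

/-! ### Testing multipliers on the de la Vallée Poussin kernels -/

theorem norm_integral_mul_le {α 𝕜 : Type*} [MeasurableSpace α] {μ : Measure α} [RCLike 𝕜]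
    {q q' : ℝ≥0∞} [ENNReal.HolderConjugate q q'] {f g : α → 𝕜}
    (hf : MemLp f q μ) (hg : MemLp g q' μ) :
    ‖∫ x, f x * g x ∂μ‖ ≤ (eLpNorm f q μ).toReal * (eLpNorm g q' μ).toReal := by
  have hHolder : eLpNorm (f • g) 1 μ ≤ eLpNorm f q μ * eLpNorm g q' μ :=
    eLpNorm_smul_le_mul_eLpNorm hg.1 hf.1
  rw [← ENNReal.toReal_mul, ← toReal_enorm]
  refine ENNReal.toReal_mono (ENNReal.mul_ne_top hf.2.ne hg.2.ne) ?_
  refine (enorm_integral_le_lintegral_enorm _).trans ?_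
  rw [eLpNorm_one_eq_lintegral_enorm] at hHolder
  simpa using hHolder

theorem integral_sum_mul_character_mul {g : Torus d → ℂ} (hg : Continuous g)
    (s : Finset (Fin d → ℤ)) (c : (Fin d → ℤ) → ℂ) :
    ∫ x, (∑ k ∈ s, c k * character k x) * g x =
      (((2 * Real.pi) ^ d : ℝ) : ℂ) * ∑ k ∈ s, c k * fourierCoeff (-k) g := by
  have hvol : (((2 * Real.pi) ^ d : ℝ) : ℂ) ≠ 0 := by exact_mod_cast (by positivity)
  have hint : ∀ k ∈ s, Integrable (fun x => c k * character k x * g x) volume := fun k _ =>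
    integrable_of_continuous ((continuous_const.mul (continuous_character k)).mul hg)
  simp only [Finset.sum_mul]
  rw [integral_finsetSum _ hint, Finset.mul_sum]
  refine Finset.sum_congr rfl fun k _ => ?_
  simp only [mul_assoc, integral_const_mul, fourierCoeff, neg_neg, mul_comm (character k _)]
  field_simp

section Multiplier

variable {p : ℝ≥0∞} [Fact (1 ≤ p)] {C : ℝ} {m : (Fin d → ℤ) → ℂ}

theorem MultiplierBound.eLpNorm_le (h : MultiplierBound (characterLp p) C m)
    {s : Finset (Fin d → ℤ)} (hm : ∀ k ∉ s, m k = 0) {g : Torus d → ℂ} (hg : Continuous g) :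
    (eLpNorm (fun x => ∑ k ∈ s, m k * fourierCoeff k g * character k x) p volume).toReal ≤
      C * (eLpNorm g p volume).toReal := by
  let G : C(Torus d, ℂ) := ⟨g, hg⟩
  have hnorm := h.norm_le_of_mem_closure_span _ (multiplierOp_characterLp p hm)
    (toLp_mem_trigClosure p G)
  have hcoeff : ∀ k, fourierCoeffLp p k (ContinuousMap.toLp p volume ℂ G) = fourierCoeff k g :=
    fun k => fourierCoeffLp_apply k (ContinuousMap.coeFn_toLp volume G)
  rw [multiplierOp_apply, norm_toLp, norm_toLp] at hnorm
  convert hnorm using 4 with x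
  · simp [hcoeff]
  · rfl

theorem MultiplierBound.norm_integral_sum_mul_le (h : MultiplierBound (characterLp p) C m) {n : ℕ}
    (hm : ∀ k ∉ latticeCube d n, m k = 0) (hm_neg : ∀ k, m (-k) = m k)
    {q q' : ℝ≥0∞} [ENNReal.HolderConjugate q q'] (hqp : q = p ∨ q' = p) {g : Torus d → ℂ}
    (hg : Continuous g) :
    ‖∫ x, (∑ k ∈ latticeCube d n, m k * character k x) * g x‖ ≤
      C * (eLpNorm (vallee d n) q volume).toReal * (eLpNorm g q' volume).toReal := by
  have hcont : ∀ c : (Fin d → ℤ) → ℂ, Continuous fun x : Torus d =>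
      ∑ k ∈ latticeCube d n, c k * character k x := fun c =>
    continuous_finsetSum _ fun k _ => continuous_const.mul (continuous_character k)
  have hV := continuous_vallee (d := d) n
  rcases hqp with rfl | rfl
  · refine (norm_integral_mul_le (q := q) (q' := q') (memLp_of_continuous (hcont _) q)
      (memLp_of_continuous hg q')).trans ?_
    gcongr
    refine (h.eLpNorm_le hm hV).trans_eq' ?_
    congr 2
    ext x
    exact Finset.sum_congr rfl fun k hk => by rw [fourierCoeff_vallee hk, mul_one]
  · have hswap : ∫ x, (∑ k ∈ latticeCube d n, m k * character k x) * g x =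
        ∫ x, (∑ k ∈ latticeCube d n, m k * fourierCoeff k g * character k x) * vallee d n x := by
      rw [integral_sum_mul_character_mul hg, integral_sum_mul_character_mul hV,
        ← sum_latticeCube_neg]
      congr 1
      refine Finset.sum_congr rfl fun k hk => ?_
      rw [fourierCoeff_vallee (neg_mem_latticeCube.2 hk), hm_neg, neg_neg, mul_one]
    simp only [hswap, mul_comm _ (vallee d n _)]
    refine (norm_integral_mul_le (q := q) (q' := q') (memLp_of_continuous hV q)
      (memLp_of_continuous (hcont _) q')).trans ?_
    rw [mul_comm C, mul_assoc]
    gcongr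
    exact h.eLpNorm_le hm hg

end Multiplier

/-! ### From the torus to the Euclidean space -/

/-- The Euclidean distance of `(e^{i x_j})_j` to `(1, …, 1)`: a continuous function on the torus
which is asymptotic to `‖x‖` at `0`. -/
def chord (x : Torus d) : ℝ := √(∑ j, ‖(fourier 1 (x j) : ℂ) - 1‖ ^ 2)

theorem continuous_chord : Continuous (chord : Torus d → ℝ) := by
  unfold chord
  fun_prop

theorem chord_nonneg (x : Torus d) : 0 ≤ chord x := Real.sqrt_nonneg _

theorem norm_fourier_one_sub_one (y : ℝ) :
    ‖(fourier 1 (y : AddCircle (2 * Real.pi)) : ℂ) - 1‖ = 2 * |Real.sin (y / 2)| := by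
  have hexp : (fourier 1 (y : AddCircle (2 * Real.pi)) : ℂ) = Complex.exp (Complex.I * y) := by
    have : (Real.pi : ℂ) ≠ 0 := by exact_mod_cast Real.pi_ne_zero
    rw [fourier_coe_apply]
    push_cast
    field_simp
  rw [hexp, Complex.norm_exp_I_mul_ofReal_sub_one, norm_mul]
  simp

theorem abs_le_chord {y : Fin d → ℝ} (hy : ∀ j, |y j| ≤ Real.pi) (j : Fin d) :
    2 / Real.pi * |y j| ≤ chord (toTorus y) := by
  have hsin : 2 / Real.pi * |y j / 2| ≤ |Real.sin (y j / 2)| := by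
    refine Real.mul_abs_le_abs_sin ?_
    rw [abs_div, abs_two]
    linarith [hy j]
  rw [abs_div, abs_two] at hsin
  have hsingle := Finset.single_le_sum (f := fun j => ‖(fourier 1 (toTorus y j) : ℂ) - 1‖ ^ 2)
    (fun i _ => sq_nonneg _) (Finset.mem_univ j)
  refine Real.le_sqrt_of_sq_le (le_trans ?_ hsingle)
  simp only [toTorus, norm_fourier_one_sub_one]
  exact pow_le_pow_left₀ (by positivity) (by linarith) 2

theorem tendsto_mul_abs_sin (t : ℝ) :
    Tendsto (fun n : ℕ => (n : ℝ) * (2 * |Real.sin ((n : ℝ)⁻¹ * t / 2)|)) atTop (𝓝 |t|) := by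
  have hderiv : HasDerivAt (fun u : ℝ => 2 * Real.sin (u * t / 2)) t 0 := by
    have hlin : HasDerivAt (fun u : ℝ => u * t / 2) (t / 2) 0 := by
      simpa using ((hasDerivAt_id (0 : ℝ)).mul_const t).div_const 2
    exact (hlin.sin.const_mul 2).congr_deriv (by simp; ring)
  have hinv : Tendsto (fun n : ℕ => ((n : ℝ))⁻¹) atTop (𝓝[≠] 0) :=
    tendsto_nhdsWithin_iff.2 ⟨tendsto_inv_atTop_zero.comp tendsto_natCast_atTop_atTop,
      (eventually_ne_atTop 0).mono fun n hn => by simpa using hn⟩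
  refine (hderiv.tendsto_slope_zero.comp hinv).abs.congr fun n => ?_
  simp [abs_mul]

theorem tendsto_mul_chord (z : Fin d → ℝ) :
    Tendsto (fun n : ℕ => (n : ℝ) * chord (toTorus ((n : ℝ)⁻¹ • z))) atTop
      (𝓝 ‖WithLp.toLp 2 z‖) := by
  have hchord : ∀ n : ℕ, (n : ℝ) * chord (toTorus ((n : ℝ)⁻¹ • z)) =
      √(∑ j, ((n : ℝ) * (2 * |Real.sin ((n : ℝ)⁻¹ * z j / 2)|)) ^ 2) := by
    intro n
    simp only [chord, toTorus, norm_fourier_one_sub_one, Pi.smul_apply, smul_eq_mul,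
      mul_pow (n : ℝ), ← Finset.mul_sum]
    rw [Real.sqrt_mul (by positivity), Real.sqrt_sq (by positivity)]
  simp only [hchord, EuclideanSpace.norm_eq, Real.norm_eq_abs]
  exact (Real.continuous_sqrt.tendsto _).comp
    (tendsto_finsetSum _ fun j _ => (tendsto_mul_abs_sin (z j)).pow 2)

/-- The fundamental cube `(-π, π]^d`. -/
def fundCube (d : ℕ) : Set (Fin d → ℝ) := Set.univ.pi fun _ => Set.Ioc (-Real.pi) Real.pi

theorem measurableSet_fundCube : MeasurableSet (fundCube d) :=
  MeasurableSet.univ_pi fun _ => measurableSet_Ioc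

theorem measurePreserving_toTorus :
    MeasurePreserving (toTorus : (Fin d → ℝ) → Torus d) (volume.restrict (fundCube d)) volume := by
  have hcircle := AddCircle.measurePreserving_mk (2 * Real.pi) (-Real.pi)
  rw [show -Real.pi + 2 * Real.pi = Real.pi by ring] at hcircle
  have hpi := measurePreserving_pi (fun _ : Fin d => volume.restrict (Set.Ioc (-Real.pi) Real.pi))
    (fun _ : Fin d => (volume : Measure (AddCircle (2 * Real.pi)))) fun _ => hcircle
  rw [← Measure.restrict_pi_pi] at hpi
  exact hpi

theorem eventually_inv_smul_mem_fundCube (z : Fin d → ℝ) :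
    ∀ᶠ n : ℕ in atTop, (n : ℝ)⁻¹ • z ∈ fundCube d := by
  have hmem : ∀ᶠ n : ℕ in atTop, ∀ j, (n : ℝ)⁻¹ * z j ∈ Set.Ioc (-Real.pi) Real.pi := by
    refine eventually_all.2 fun j => ?_
    have hlim : Tendsto (fun n : ℕ => (n : ℝ)⁻¹ * z j) atTop (𝓝 (0 * z j)) :=
      (tendsto_inv_atTop_zero.comp tendsto_natCast_atTop_atTop).mul_const _
    rw [zero_mul] at hlim
    exact hlim.eventually (Ioc_mem_nhds (neg_neg_of_pos Real.pi_pos) Real.pi_pos)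
  exact hmem.mono fun n hn j _ => hn j

theorem norm_le_of_mul_chord_le {n : ℕ} (hn : 1 ≤ n) {z : Fin d → ℝ}
    (hz : (n : ℝ)⁻¹ • z ∈ fundCube d) {A : ℝ} (hA : n * chord (toTorus ((n : ℝ)⁻¹ • z)) ≤ A) :
    ‖z‖ ≤ Real.pi / 2 * A := by
  have hn' : (0 : ℝ) < n := by exact_mod_cast hn
  have hA₀ : 0 ≤ A := (mul_nonneg hn'.le (chord_nonneg _)).trans hA
  refine (pi_norm_le_iff_of_nonneg (by positivity)).2 fun j => ?_
  have hchord := abs_le_chord (fun j => abs_le.2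
    ⟨(hz j (Set.mem_univ j)).1.le, (hz j (Set.mem_univ j)).2⟩) j
  rw [Pi.smul_apply, smul_eq_mul, abs_mul, abs_of_pos (inv_pos.2 hn')] at hchord
  calc ‖z j‖ = Real.pi / 2 * (n * (2 / Real.pi * ((n : ℝ)⁻¹ * |z j|))) := by
        rw [Real.norm_eq_abs]
        field_simp
    _ ≤ Real.pi / 2 * (n * chord (toTorus ((n : ℝ)⁻¹ • z))) := by gcongr
    _ ≤ Real.pi / 2 * A := by gcongr

theorem pow_mul_integral_torus {φ : Torus d → ℝ} (hφ : Continuous φ) {n : ℕ} (hn : 1 ≤ n) :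
    (n : ℝ) ^ d * ∫ x, φ x =
      ∫ z : Fin d → ℝ, (fundCube d).indicator (fun y => φ (toTorus y)) ((n : ℝ)⁻¹ • z) := by
  have : (0 : ℝ) < n := by exact_mod_cast hn
  rw [Measure.integral_comp_smul, integral_indicator measurableSet_fundCube,
    Module.finrank_fin_fun, inv_pow, inv_inv, abs_of_pos (by positivity), smul_eq_mul,
    ← (measurePreserving_toTorus (d := d)).map_eq,
    integral_map (measurePreserving_toTorus (d := d)).aemeasurable hφ.aestronglyMeasurable]

theorem tendsto_pow_mul_integral {φ : ℕ → Torus d → ℝ} {Φ : EuclideanSpace ℝ (Fin d) → ℝ}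
    {M A : ℝ} (hφ : ∀ n, Continuous (φ n)) (hM : ∀ n, 1 ≤ n → ∀ x, |φ n x| ≤ M)
    (hA : ∀ n : ℕ, 1 ≤ n → ∀ x, A ≤ n * chord x → φ n x = 0)
    (hlim : ∀ z, Tendsto (fun n : ℕ => φ n (toTorus ((n : ℝ)⁻¹ • z))) atTop
      (𝓝 (Φ (WithLp.toLp 2 z)))) :
    Tendsto (fun n : ℕ => (n : ℝ) ^ d * ∫ x, φ n x) atTop (𝓝 (∫ y, Φ y)) := by
  rw [← (PiLp.volume_preserving_toLp (Fin d)).integral_comp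
    (MeasurableEquiv.toLp 2 _).measurableEmbedding]
  have hev := (eventually_ge_atTop 1).mono fun n hn => (pow_mul_integral_torus (hφ n) hn).symm
  refine Tendsto.congr' hev ?_
  have hM₀ : 0 ≤ M := (abs_nonneg _).trans (hM 1 le_rfl 0)
  refine tendsto_integral_filter_of_dominated_convergence
    ((Metric.closedBall (0 : Fin d → ℝ) (Real.pi / 2 * A)).indicator fun _ => M) ?_ ?_ ?_ ?_
  · refine .of_forall fun n => ?_
    have hmeas : Measurable fun y : Fin d → ℝ => φ n (toTorus y) :=
      (hφ n).measurable.comp (measurable_pi_iff.2 fun j =>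
        AddCircle.measurable_mk'.comp (measurable_pi_apply j))
    exact ((hmeas.indicator measurableSet_fundCube).comp
      (measurable_const_smul (n : ℝ)⁻¹)).aestronglyMeasurable
  · filter_upwards [eventually_ge_atTop 1] with n hn
    refine ae_of_all _ fun z => ?_
    have hnonneg : 0 ≤ (Metric.closedBall (0 : Fin d → ℝ) (Real.pi / 2 * A)).indicator
        (fun _ => M) z := Set.indicator_nonneg (fun _ _ => hM₀) _
    by_cases hz : (n : ℝ)⁻¹ • z ∈ fundCube d
    · rw [Set.indicator_of_mem hz]
      rcases le_total A (n * chord (toTorus ((n : ℝ)⁻¹ • z))) with hlarge | hsmall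
      · rwa [hA n hn _ hlarge, norm_zero]
      · rw [Set.indicator_of_mem
          (mem_closedBall_zero_iff.2 (norm_le_of_mul_chord_le hn hz hsmall))]
        exact hM n hn _
    · rwa [Set.indicator_of_notMem hz, norm_zero]
  · rw [integrable_indicator_iff Metric.isClosed_closedBall.measurableSet]
    exact integrableOn_const measure_closedBall_lt_top.ne
  · refine ae_of_all _ fun z => (hlim z).congr' ?_
    filter_upwards [eventually_inv_smul_mem_fundCube z] with n hn
    rw [Set.indicator_of_mem hn]

/-! ### The kernel as a Riemann sum -/

open scoped Pointwise in
theorem inter_smul_lattice_eq {n : ℕ} (hn : 1 ≤ n) :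
    Metric.closedBall (0 : Fin d → ℝ) 1 ∩ (n : ℝ)⁻¹ •
      (Submodule.span ℤ (Set.range (Pi.basisFun ℝ (Fin d))) : Set (Fin d → ℝ)) =
      ((latticeCube d n).image fun k j => (k j : ℝ) / n : Finset (Fin d → ℝ)) := by
  have hn' : (0 : ℝ) < n := by exact_mod_cast hn
  have hnorm : ∀ k : Fin d → ℤ, ‖fun j => (k j : ℝ) / n‖ ≤ 1 ↔ k ∈ latticeCube d n := by
    intro k
    simp only [pi_norm_le_iff_of_nonneg zero_le_one, mem_latticeCube, Real.norm_eq_abs, abs_div,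
      abs_of_pos hn', div_le_one hn']
    exact forall_congr' fun j => by exact_mod_cast Iff.rfl
  ext x
  simp only [Set.mem_inter_iff, mem_closedBall_zero_iff, Finset.coe_image, Set.mem_image,
    Set.mem_smul_set, SetLike.mem_coe, Module.Basis.mem_span_iff_repr_mem, Pi.basisFun_repr]
  constructor
  · rintro ⟨hx, y, hy, rfl⟩
    choose k hk using hy
    have hky : (fun j => (k j : ℝ) / n) = (n : ℝ)⁻¹ • y :=
      funext fun j => by simpa [div_eq_inv_mul] using Or.inl (hk j)
    exact ⟨k, (hnorm k).1 (hky ▸ hx), hky⟩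
  · rintro ⟨k, hk, rfl⟩
    exact ⟨(hnorm k).2 hk, fun j => k j, fun j => ⟨k j, rfl⟩,
      funext fun j => by simp [div_eq_inv_mul]⟩

theorem tendsto_riemann_sum {F : (Fin d → ℝ) → ℝ} (hF : Continuous F) :
    Tendsto (fun n : ℕ => (∑ k ∈ latticeCube d n, F fun j => (k j : ℝ) / n) / (n : ℝ) ^ d) atTop
      (𝓝 (∫ x in Metric.closedBall (0 : Fin d → ℝ) 1, F x)) := by
  have hlim := tendsto_tsum_div_pow_atTop_integral (Metric.closedBall (0 : Fin d → ℝ) 1) F hF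
    Metric.isBounded_closedBall Metric.isClosed_closedBall.measurableSet
    ((convex_closedBall _ _).addHaar_frontier _)
  refine hlim.congr' ?_
  filter_upwards [eventually_ge_atTop 1] with n hn
  have hn₀ : (n : ℝ) ≠ 0 := by positivity
  rw [inter_smul_lattice_eq hn, Fintype.card_fin, Finset.tsum_subtype' _ F, Finset.sum_image]
  intro k _ l _ hkl
  ext j
  exact_mod_cast (div_left_inj' hn₀).1 (congrFun hkl j)

/-- The real part of the Bochner–Riesz kernel on the torus, divided by `n^d`. -/
def scaledKernel (d : ℕ) (δ : ℝ) (n : ℕ) (x : Torus d) : ℝ :=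
  (∑ k ∈ latticeCube d n, weight 2 δ n k * (character k x).re) / (n : ℝ) ^ d

theorem continuous_scaledKernel (δ : ℝ) (n : ℕ) : Continuous (scaledKernel d δ n) := by
  have hre := fun k : Fin d → ℤ => Complex.continuous_re.comp (continuous_character k)
  exact (continuous_finsetSum _ fun k _ => continuous_const.mul (hre k)).div_const _

theorem weight_two_eq (δ : ℝ) (n : ℕ) (k : Fin d → ℤ) :
    weight 2 δ n k = rieszSymbol δ (WithLp.toLp 2 fun j => (k j : ℝ) / n) := by
  rw [weight_eq, rieszSymbol, eucl, EuclideanSpace.real_norm_sq_eq,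
    Real.sq_sqrt (Finset.sum_nonneg fun j _ => sq_nonneg _)]
  simp [div_pow, Finset.sum_div]

theorem abs_scaledKernel_le {δ : ℝ} (hδ : 0 ≤ δ) {n : ℕ} (hn : 1 ≤ n) (x : Torus d) :
    |scaledKernel d δ n x| ≤ 3 ^ d := by
  have hn' : (1 : ℝ) ≤ n := by exact_mod_cast hn
  have hterm : ∀ k ∈ latticeCube d n, |weight 2 δ n k * (character k x).re| ≤ 1 := by
    intro k _
    rw [abs_mul, weight_two_eq, abs_of_nonneg (rieszSymbol_nonneg _ _)]
    exact mul_le_one₀ (rieszSymbol_le_one hδ _) (abs_nonneg _)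
      ((Complex.abs_re_le_norm _).trans (norm_character k x).le)
  have hcard : (((latticeCube d n).card • (1 : ℝ) : ℝ)) ≤ 3 ^ d * (n : ℝ) ^ d := by
    rw [card_latticeCube, nsmul_one, ← mul_pow]
    push_cast
    gcongr
    linarith
  rw [scaledKernel, abs_div, abs_of_pos (by positivity : (0 : ℝ) < (n : ℝ) ^ d),
    div_le_iff₀ (by positivity)]
  exact (Finset.abs_sum_le_sum_abs _ _).trans ((Finset.sum_le_card_nsmul _ _ _ hterm).trans hcard)

theorem setIntegral_rieszSymbol_mul_cos {δ : ℝ} (hδ : 0 < δ) (z : Fin d → ℝ) :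
    ∫ x in Metric.closedBall (0 : Fin d → ℝ) 1,
      rieszSymbol δ (WithLp.toLp 2 x) * Real.cos (∑ j, x j * z j) =
      rieszKernel δ (WithLp.toLp 2 z) := by
  rw [setIntegral_eq_integral_of_forall_compl_eq_zero, rieszKernel,
    ← (PiLp.volume_preserving_toLp (Fin d)).integral_comp
      (MeasurableEquiv.toLp 2 _).measurableEmbedding]
  · simp [PiLp.inner_apply, mul_comm]
  · intro x hx
    have hxnorm : 1 ≤ ‖WithLp.toLp 2 x‖ :=
      (not_le.1 (mt mem_closedBall_zero_iff.2 hx)).le.trans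
        ((pi_norm_le_iff_of_nonneg (norm_nonneg _)).2 (PiLp.norm_apply_le (WithLp.toLp 2 x)))
    rw [rieszSymbol_eq_zero hδ hxnorm, zero_mul]

theorem tendsto_scaledKernel {δ : ℝ} (hδ : 0 < δ) (z : Fin d → ℝ) :
    Tendsto (fun n : ℕ => scaledKernel d δ n (toTorus ((n : ℝ)⁻¹ • z))) atTop
      (𝓝 (rieszKernel δ (WithLp.toLp 2 z))) := by
  have hF : Continuous fun x : Fin d → ℝ =>
      rieszSymbol δ (WithLp.toLp 2 x) * Real.cos (∑ j, x j * z j) :=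
    ((continuous_rieszSymbol hδ.le).comp (PiLp.continuous_toLp 2 _)).mul (by fun_prop)
  rw [← setIntegral_rieszSymbol_mul_cos hδ]
  refine (tendsto_riemann_sum hF).congr fun n => ?_
  rw [scaledKernel]
  congr 1
  refine Finset.sum_congr rfl fun k _ => ?_
  rw [weight_two_eq, character_toTorus, mul_comm Complex.I, Complex.exp_ofReal_mul_I_re]
  congr 2
  refine Finset.sum_congr rfl fun j _ => ?_
  simp only [Pi.smul_apply, smul_eq_mul]
  ring

/-! ### Transference -/

theorem toReal_inv_add_toReal_inv (q q' : ℝ≥0∞) [ENNReal.HolderConjugate q q'] :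
    (q⁻¹).toReal + (q'⁻¹).toReal = 1 := by
  have hsum := ENNReal.HolderConjugate.inv_add_inv_eq_one q q'
  rw [← ENNReal.toReal_add (by simpa using ENNReal.HolderConjugate.ne_zero q q')
    (by simpa using ENNReal.HolderConjugate.ne_zero q' q), hsum, ENNReal.toReal_one]

theorem toReal_eLpNorm_eq_integral {α E : Type*} [MeasurableSpace α] {μ : Measure α}
    [NormedAddCommGroup E] {f : α → E} (hf : AEStronglyMeasurable f μ) {q : ℝ≥0∞} (hq₀ : q ≠ 0)
    (hq_top : q ≠ ∞) :
    (eLpNorm f q μ).toReal = (∫ x, ‖f x‖ ^ q.toReal ∂μ) ^ (q⁻¹).toReal := by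
  rw [toReal_eLpNorm hf, lpNorm_eq_integral_norm_rpow_toReal hq₀ hq_top hf, ENNReal.toReal_inv]

theorem pow_mul_integral_scaledKernel_mul {δ : ℝ} {n : ℕ} (hn : 1 ≤ n) {g : Torus d → ℝ}
    (hg : Continuous g) :
    (n : ℝ) ^ d * ∫ x, scaledKernel d δ n x * g x =
      (∫ x, (∑ k ∈ latticeCube d n, (weight 2 δ n k : ℂ) * character k x) * (g x : ℂ)).re := by
  have hcont : Continuous fun x : Torus d =>
      (∑ k ∈ latticeCube d n, (weight 2 δ n k : ℂ) * character k x) * (g x : ℂ) :=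
    (continuous_finsetSum _ fun k _ => continuous_const.mul (continuous_character k)).mul
      (Complex.continuous_ofReal.comp hg)
  have hre := integral_re (𝕜 := ℂ) (integrable_of_continuous hcont)
  simp only [RCLike.re_to_complex] at hre
  rw [← hre, ← integral_const_mul]
  congr 1
  ext x
  simp only [Complex.re_mul_ofReal, Complex.re_sum, Complex.re_ofReal_mul]
  rw [scaledKernel, ← mul_assoc, mul_div_cancel₀ _ (by positivity)]

section Transference

variable {p : ℝ≥0∞} [Fact (1 ≤ p)] {C δ : ℝ} {q q' : ℝ≥0∞} [ENNReal.HolderConjugate q q']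

theorem abs_integral_scaledKernel_mul_le (hC : 0 ≤ C) (hδ : 0 < δ) {n : ℕ} (hn : 1 ≤ n)
    (h : MultiplierBound (characterLp p (d := d)) C fun k => (weight 2 δ n k : ℂ))
    (hqp : q = p ∨ q' = p) {g : Torus d → ℝ} (hg : Continuous g) :
    |(n : ℝ) ^ d * ∫ x, scaledKernel d δ n x * g x| ≤
      C * (4 * Real.pi) ^ d * ((5 : ℝ) ^ d) ^ (q'⁻¹).toReal *
        (((n : ℝ) ^ d) ^ (q'⁻¹).toReal * (eLpNorm g q' volume).toReal) := by
  have hn' : (1 : ℝ) ≤ n := by exact_mod_cast hn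
  have hzero : ∀ k ∉ latticeCube d n, (weight 2 δ n k : ℂ) = 0 := fun k hk => by
    rw [weight_eq_zero_of_notMem two_pos hδ hn hk, Complex.ofReal_zero]
  have hnorm := h.norm_integral_sum_mul_le hzero (fun k => by rw [weight_neg]) hqp
    (Complex.continuous_ofReal.comp hg)
  have hgnorm : eLpNorm (fun x => (g x : ℂ)) q' volume = eLpNorm g q' volume :=
    eLpNorm_congr_norm_ae (ae_of_all _ fun x => Complex.norm_real _)
  have hvallee := eLpNorm_vallee_le (d := d) (ENNReal.HolderConjugate.one_le q q') n
  rw [sub_eq_of_eq_add' (toReal_inv_add_toReal_inv q q').symm] at hvallee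
  have hpow : ((4 * n + 1 : ℝ) ^ d) ^ (q'⁻¹).toReal ≤
      ((5 : ℝ) ^ d) ^ (q'⁻¹).toReal * ((n : ℝ) ^ d) ^ (q'⁻¹).toReal := by
    rw [← Real.mul_rpow (by positivity) (by positivity), ← mul_pow]
    gcongr
    linarith
  rw [pow_mul_integral_scaledKernel_mul hn hg]
  calc _ ≤ C * (eLpNorm (vallee d n) q volume).toReal * (eLpNorm g q' volume).toReal :=
        (Complex.abs_re_le_norm _).trans (hgnorm ▸ hnorm)
    _ ≤ C * ((4 * Real.pi) ^ d * (((5 : ℝ) ^ d) ^ (q'⁻¹).toReal *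
        ((n : ℝ) ^ d) ^ (q'⁻¹).toReal)) * (eLpNorm g q' volume).toReal := by
        gcongr
        exact hvallee.trans (by gcongr)
    _ = _ := by ring

section Profile

variable {Γ : ℝ → ℝ}

theorem exists_abs_le_of_eq_zero (hΓ : Continuous Γ) {A : ℝ} (hA : ∀ r, A ≤ r → Γ r = 0) :
    ∃ M, ∀ r, 0 ≤ r → |Γ r| ≤ M := by
  obtain ⟨M, hM⟩ := (isCompact_Icc (a := (0 : ℝ)) (b := A)).exists_bound_of_continuousOn
    hΓ.continuousOn
  refine ⟨max M 0, fun r hr => ?_⟩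
  rcases le_or_gt A r with hlarge | hsmall
  · rw [hA r hlarge, abs_zero]
    exact le_max_right _ _
  · exact (hM r ⟨hr, hsmall.le⟩).trans (le_max_left _ _)

theorem continuous_comp_mul_chord (hΓ : Continuous Γ) (n : ℕ) :
    Continuous fun x : Torus d => Γ (n * chord x) :=
  hΓ.comp (continuous_const.mul continuous_chord)

theorem tendsto_comp_mul_chord (hΓ : Continuous Γ) (z : Fin d → ℝ) :
    Tendsto (fun n : ℕ => Γ (n * chord (toTorus ((n : ℝ)⁻¹ • z)))) atTop
      (𝓝 (Γ ‖WithLp.toLp 2 z‖)) :=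
  (hΓ.tendsto _).comp (tendsto_mul_chord z)

theorem tendsto_pow_mul_integral_scaledKernel_mul (hΓ : Continuous Γ) (hδ : 0 < δ) {A : ℝ}
    (hA : ∀ r, A ≤ r → Γ r = 0) :
    Tendsto (fun n : ℕ => (n : ℝ) ^ d * ∫ x, scaledKernel d δ n x * Γ (n * chord x)) atTop
      (𝓝 (∫ y : EuclideanSpace ℝ (Fin d), rieszKernel δ y * Γ ‖y‖)) := by
  obtain ⟨M, hM⟩ := exists_abs_le_of_eq_zero hΓ hA
  refine tendsto_pow_mul_integral
    (φ := fun n x => scaledKernel d δ n x * Γ (n * chord x)) (M := 3 ^ d * M) (A := A)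
    (fun n => (continuous_scaledKernel δ n).mul (continuous_comp_mul_chord hΓ n))
    (fun n hn x => ?_) (fun n _ x hx => by rw [hA _ hx, mul_zero])
    fun z => (tendsto_scaledKernel hδ z).mul (tendsto_comp_mul_chord hΓ z)
  rw [abs_mul]
  gcongr
  · exact abs_scaledKernel_le hδ.le hn x
  · exact hM _ (mul_nonneg n.cast_nonneg (chord_nonneg x))

theorem tendsto_eLpNorm_comp_mul_chord (hΓ : Continuous Γ) {A : ℝ} (hA : ∀ r, A ≤ r → Γ r = 0)
    {q : ℝ≥0∞} (hq₀ : q ≠ 0) (hq_top : q ≠ ∞) :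
    Tendsto (fun n : ℕ => ((n : ℝ) ^ d) ^ (q⁻¹).toReal *
        (eLpNorm (fun x : Torus d => Γ (n * chord x)) q volume).toReal) atTop
      (𝓝 (eLpNorm (fun y : EuclideanSpace ℝ (Fin d) => Γ ‖y‖) q volume).toReal) := by
  obtain ⟨M, hM⟩ := exists_abs_le_of_eq_zero hΓ hA
  have hpos : 0 < q.toReal := ENNReal.toReal_pos hq₀ hq_top
  have hlim : Tendsto (fun n : ℕ => (n : ℝ) ^ d * ∫ x : Torus d, |Γ (n * chord x)| ^ q.toReal) atTop
      (𝓝 (∫ y : EuclideanSpace ℝ (Fin d), |Γ ‖y‖| ^ q.toReal)) := by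
    refine tendsto_pow_mul_integral (M := M ^ q.toReal) (A := A)
      (fun n => (continuous_comp_mul_chord hΓ n).abs.rpow_const fun _ => .inr hpos.le)
      (fun n _ x => ?_) (fun n _ x hx => by rw [hA _ hx, abs_zero, Real.zero_rpow hpos.ne'])
      fun z => (tendsto_comp_mul_chord hΓ z).abs.rpow_const (.inr hpos.le)
    rw [abs_of_nonneg (by positivity)]
    gcongr
    exact hM _ (mul_nonneg n.cast_nonneg (chord_nonneg x))
  rw [toReal_eLpNorm_eq_integral (by fun_prop) hq₀ hq_top]
  refine (hlim.rpow_const (.inr ENNReal.toReal_nonneg)).congr fun n => ?_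
  rw [toReal_eLpNorm_eq_integral (continuous_comp_mul_chord hΓ n).aestronglyMeasurable hq₀ hq_top,
    Real.mul_rpow (by positivity) (by positivity)]
  rfl

theorem eLpNorm_top_comp_mul_chord_le (hΓ : Continuous Γ) {A : ℝ}
    (hA : ∀ r, A ≤ r → Γ r = 0) (n : ℕ) :
    (eLpNorm (fun x : Torus (d + 1) => Γ (n * chord x)) ∞ volume).toReal ≤
      (eLpNorm (fun y : EuclideanSpace ℝ (Fin (d + 1)) => Γ ‖y‖) ∞ volume).toReal := by
  obtain ⟨M, hM⟩ := exists_abs_le_of_eq_zero hΓ hA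
  simp only [eLpNorm_exponent_top]
  set S := eLpNormEssSup (fun y : EuclideanSpace ℝ (Fin (d + 1)) => Γ ‖y‖) volume
  have hS : S ≠ ∞ :=
    (eLpNormEssSup_lt_top_of_ae_bound (ae_of_all _ fun y => hM _ (norm_nonneg y))).ne
  have hdense : Dense {y : EuclideanSpace ℝ (Fin (d + 1)) | ‖Γ ‖y‖‖ₑ ≤ S} :=
    Measure.dense_of_ae (enorm_ae_le_eLpNormEssSup _ volume)
  have hclosed : IsClosed {y : EuclideanSpace ℝ (Fin (d + 1)) | ‖Γ ‖y‖‖ₑ ≤ S} :=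
    isClosed_le (by fun_prop) continuous_const
  refine ENNReal.toReal_mono hS (eLpNormEssSup_le_of_ae_enorm_bound (ae_of_all _ fun x => ?_))
  obtain ⟨y, hy⟩ := exists_norm_eq (EuclideanSpace ℝ (Fin (d + 1)))
    (mul_nonneg n.cast_nonneg (chord_nonneg x))
  rw [← hy]
  exact (hclosed.closure_eq ▸ hdense.closure_eq).ge (Set.mem_univ y)

end Profile

theorem exists_abs_integral_rieszKernel_mul_le (hδ : 0 < δ)
    (h : ∀ n : ℕ, MultiplierBound (characterLp p (d := d + 1)) C
      fun k => (weight 2 δ (n + 1) k : ℂ)) (hqp : q = p ∨ q' = p) :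
    ∃ K, 0 ≤ K ∧ ∀ (Γ : ℝ → ℝ) (A : ℝ), Continuous Γ → (∀ r, A ≤ r → Γ r = 0) →
      |∫ y : EuclideanSpace ℝ (Fin (d + 1)), rieszKernel δ y * Γ ‖y‖| ≤
        K * (eLpNorm (fun y : EuclideanSpace ℝ (Fin (d + 1)) => Γ ‖y‖) q' volume).toReal := by
  refine ⟨|C| * (4 * Real.pi) ^ (d + 1) * ((5 : ℝ) ^ (d + 1)) ^ (q'⁻¹).toReal, by positivity,
    fun Γ A hΓ hA => ?_⟩
  have hlim := (tendsto_pow_mul_integral_scaledKernel_mul (d := d + 1) hΓ hδ hA).abs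
  have hbound : ∀ᶠ n : ℕ in atTop, _ := (eventually_ge_atTop 1).mono fun n hn =>
    abs_integral_scaledKernel_mul_le (q := q) (q' := q') (abs_nonneg C) hδ hn
      (Nat.sub_add_cancel hn ▸ (h (n - 1)).mono (le_abs_self C)) hqp
      (continuous_comp_mul_chord hΓ n)
  rcases eq_or_ne q' ∞ with rfl | hq'
  · refine le_of_tendsto hlim (hbound.mono fun n hn => hn.trans ?_)
    gcongr
    simpa using eLpNorm_top_comp_mul_chord_le hΓ hA n
  · exact le_of_tendsto_of_tendsto hlim ((tendsto_eLpNorm_comp_mul_chord hΓ hA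
      (ENNReal.HolderConjugate.ne_zero q' q) hq').const_mul _) hbound

end Transference

/-! ### Extremal radial profiles -/

/-- A continuous cutoff, equal to `1` on `[2, R]` and supported in `[1, R + 1]`. -/
def plateau (R r : ℝ) : ℝ := max 0 (min 1 (min (r - 1) (R + 1 - r)))

theorem continuous_plateau (R : ℝ) : Continuous (plateau R) := by
  unfold plateau
  fun_prop

theorem plateau_nonneg (R r : ℝ) : 0 ≤ plateau R r := le_max_left _ _

theorem plateau_le_one (R r : ℝ) : plateau R r ≤ 1 := max_le zero_le_one (min_le_left _ _)

theorem plateau_eq_zero_of_le_one {R r : ℝ} (h : r ≤ 1) : plateau R r = 0 :=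
  max_eq_left ((min_le_right _ _).trans ((min_le_left _ _).trans (by linarith)))

theorem plateau_eq_zero_of_add_one_le {R r : ℝ} (h : R + 1 ≤ r) : plateau R r = 0 :=
  max_eq_left ((min_le_right _ _).trans ((min_le_right _ _).trans (by linarith)))

theorem plateau_eq_one {R r : ℝ} (h : 2 ≤ r) (h' : r ≤ R) : plateau R r = 1 := by
  rw [plateau, min_eq_left (le_min (by linarith) (by linarith)), max_eq_right zero_le_one]

/-- The radial profile against which the kernel of order `δ` on `ℝ^(d+1)` is tested. Since the
Bessel integral oscillates like `r ^ (-(δ + d / 2 + 1))`, the profile has size `r ^ (δ - d / 2)`,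
and its product with the kernel is non-negative and of average size `r ^ (-(d + 1))`. -/
def extremal (d : ℕ) (δ R r : ℝ) : ℝ :=
  besselIntegral (δ + d / 2) r * r ^ (2 * δ + 1) * plateau R r

theorem extremal_eq_zero_of_le_one {δ R r : ℝ} (h : r ≤ 1) : extremal d δ R r = 0 := by
  rw [extremal, plateau_eq_zero_of_le_one h, mul_zero]

theorem extremal_eq_zero_of_add_one_le {δ R r : ℝ} (h : R + 1 ≤ r) : extremal d δ R r = 0 := by
  rw [extremal, plateau_eq_zero_of_add_one_le h, mul_zero]

theorem pow_mul_besselIntegral_mul_extremal (δ R : ℝ) {r : ℝ} (hr : 0 < r) :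
    r ^ d * (besselIntegral (δ + d / 2) r * extremal d δ R r) =
      (r ^ (δ + d / 2 + 1) * besselIntegral (δ + d / 2) r) ^ 2 / r * plateau R r := by
  have hexp : r ^ d * r ^ (2 * δ + 1) = (r ^ (δ + d / 2 + 1)) ^ 2 / r := by
    rw [eq_div_iff hr.ne', ← Real.rpow_natCast, ← Real.rpow_natCast, ← Real.rpow_mul hr.le,
      ← Real.rpow_add hr, ← Real.rpow_add_one hr.ne']
    congr 1
    push_cast
    ring
  calc _ = r ^ d * r ^ (2 * δ + 1) * besselIntegral (δ + d / 2) r ^ 2 * plateau R r := by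
        rw [extremal]
        ring
    _ = _ := by
        rw [hexp]
        ring

/-- The surface area of the unit sphere of `ℝ^(d+1)`. -/
def sphereArea (d : ℕ) : ℝ :=
  (d + 1) * (volume : Measure (EuclideanSpace ℝ (Fin (d + 1)))).real (Metric.ball 0 1)

theorem sphereArea_pos : 0 < sphereArea d :=
  mul_pos (by positivity)
    (ENNReal.toReal_pos (Metric.measure_ball_pos _ _ one_pos).ne' measure_ball_lt_top.ne)

theorem integral_comp_norm (f : ℝ → ℝ) :
    ∫ y : EuclideanSpace ℝ (Fin (d + 1)), f ‖y‖ =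
      sphereArea d * ∫ r in Set.Ioi (0 : ℝ), r ^ d * f r := by
  rw [integral_fun_norm_addHaar volume f, finrank_euclideanSpace_fin]
  simp [sphereArea, mul_assoc]

section Extremal

variable {δ : ℝ}

theorem continuous_extremal (hδ : 0 < δ) (R : ℝ) : Continuous (extremal d δ R) :=
  ((continuous_besselIntegral (by positivity)).mul
    (Real.continuous_rpow_const (by positivity))).mul (continuous_plateau R)

theorem integral_sq_besselIntegral_le_integral_extremal (hδ : 0 < δ) {R : ℝ} (hR : 2 ≤ R) :
    ∫ r in 2..R, (r ^ (δ + d / 2 + 1) * besselIntegral (δ + d / 2) r) ^ 2 / r ≤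
      ∫ r in Set.Ioi (0 : ℝ), r ^ d * (besselIntegral (δ + d / 2) r * extremal d δ R r) := by
  have hcont : Continuous fun r => r ^ d * (besselIntegral (δ + d / 2) r * extremal d δ R r) :=
    (continuous_pow d).mul ((continuous_besselIntegral (by positivity)).mul
      (continuous_extremal hδ R))
  have hplateau : ∫ r in 2..R, (r ^ (δ + d / 2 + 1) * besselIntegral (δ + d / 2) r) ^ 2 / r =
      ∫ r in Set.Ioc 2 R, r ^ d * (besselIntegral (δ + d / 2) r * extremal d δ R r) := by
    rw [intervalIntegral.integral_of_le hR]
    refine setIntegral_congr_fun measurableSet_Ioc fun r hr => ?_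
    rw [pow_mul_besselIntegral_mul_extremal _ _ (by linarith [hr.1]),
      plateau_eq_one hr.1.le hr.2, mul_one]
  rw [hplateau]
  refine setIntegral_mono_set ?_ ?_ (LE.le.eventuallyLE fun r hr => two_pos.trans hr.1)
  · refine IntegrableOn.of_forall_sdiff_eq_zero (s := Set.Icc 0 (R + 1))
      hcont.continuousOn.integrableOn_Icc measurableSet_Ioi fun r hr => ?_
    have hlarge : R + 1 ≤ r := (not_le.1 fun h => hr.2 ⟨(Set.mem_Ioi.1 hr.1).le, h⟩).le
    rw [extremal_eq_zero_of_add_one_le hlarge, mul_zero, mul_zero]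
  · filter_upwards [ae_restrict_mem measurableSet_Ioi] with r hr
    have : 0 < r := hr
    rw [pow_mul_besselIntegral_mul_extremal _ _ hr]
    exact mul_nonneg (by positivity) (plateau_nonneg _ _)

theorem exists_log_le_integral_extremal (hδ : 0 < δ) :
    ∃ a b, 0 < a ∧ ∀ R, 2 ≤ R → a * Real.log R - b ≤ ∫ r in Set.Ioi (0 : ℝ),
      r ^ d * (besselIntegral (δ + d / 2) r * extremal d δ R r) := by
  obtain ⟨a, C, ha, hlog⟩ := exists_log_le_integral_besselIntegral
    (ν := δ + d / 2) (by positivity)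
  set w : ℝ → ℝ := fun r => (r ^ (δ + d / 2 + 1) * besselIntegral (δ + d / 2) r) ^ 2 / r
  have hcont : ContinuousOn w (Set.Ioi 0) :=
    (((Real.continuous_rpow_const (by positivity)).mul
      (continuous_besselIntegral (by positivity))).pow 2).continuousOn.div continuousOn_id
        fun r hr => ne_of_gt hr
  have hint : ∀ {u v : ℝ}, 0 < u → 0 < v → IntervalIntegrable w volume u v := fun hu hv =>
    (hcont.mono fun r hr => (lt_min hu hv).trans_le hr.1).intervalIntegrable
  refine ⟨a, C + ∫ r in (1 : ℝ)..2, w r, ha, fun R hR => ?_⟩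
  have hsplit := intervalIntegral.integral_add_adjacent_intervals
    (hint one_pos two_pos) (hint two_pos (by linarith : 0 < R))
  linarith [hlog R (by linarith), integral_sq_besselIntegral_le_integral_extremal (d := d) hδ hR]

theorem exists_log_le_integral_rieszKernel_mul_extremal (hδ : 0 < δ) :
    ∃ a b, 0 < a ∧ ∀ R, 2 ≤ R → a * Real.log R - b ≤
      ∫ y : EuclideanSpace ℝ (Fin (d + 1)), rieszKernel δ y * extremal d δ R ‖y‖ := by
  obtain ⟨a, b, ha, hlog⟩ := exists_log_le_integral_extremal (d := d) hδ
  set I := ∫ ξ : EuclideanSpace ℝ (Fin d), rieszSymbol δ ξ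
  have hI : 0 < I := integral_rieszSymbol_pos hδ
  have hS : 0 < sphereArea d := sphereArea_pos
  refine ⟨I * sphereArea d * a, I * sphereArea d * b, by positivity, fun R hR => ?_⟩
  simp only [rieszKernel_eq_besselIntegral hδ, mul_assoc, integral_const_mul,
    integral_comp_norm fun r => besselIntegral (δ + d / 2) r * extremal d δ R r]
  rw [← mul_sub, ← mul_sub]
  gcongr
  exact hlog R hR

theorem exists_abs_extremal_le (hδ : 0 < δ) :
    ∃ B, 0 ≤ B ∧ ∀ R r, 1 ≤ r → |extremal d δ R r| ≤ B * r ^ (δ - d / 2) := by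
  obtain ⟨B, hB⟩ := exists_abs_rpow_mul_besselIntegral_le (ν := δ + d / 2) (by positivity)
  refine ⟨B, (abs_nonneg _).trans (hB 1 le_rfl), fun R r hr => ?_⟩
  have hr₀ : 0 < r := by linarith
  have hpow : 0 ≤ r ^ (δ - d / 2) := by positivity
  have hexp : r ^ (2 * δ + 1) = r ^ (δ + d / 2 + 1) * r ^ (δ - d / 2) := by
    rw [← Real.rpow_add hr₀]
    congr 1
    ring
  calc |extremal d δ R r|
      = |r ^ (δ + d / 2 + 1) * besselIntegral (δ + d / 2) r| * r ^ (δ - d / 2) * plateau R r := by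
        rw [← abs_of_nonneg hpow, ← abs_mul, ← abs_of_nonneg (plateau_nonneg R r), ← abs_mul,
          extremal, hexp]
        ring_nf
    _ ≤ |r ^ (δ + d / 2 + 1) * besselIntegral (δ + d / 2) r| * r ^ (δ - d / 2) :=
        mul_le_of_le_one_right (by positivity) (plateau_le_one R r)
    _ ≤ B * r ^ (δ - d / 2) := by
        gcongr
        exact hB r hr

theorem integral_abs_extremal_rpow_le (hδ : 0 < δ) {B : ℝ} (hB₀ : 0 ≤ B)
    (hB : ∀ R r, 1 ≤ r → |extremal d δ R r| ≤ B * r ^ (δ - d / 2)) {t : ℝ} (ht : 0 < t)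
    (hcrit : (δ - d / 2) * t ≤ -(d + 1)) {R : ℝ} (hR : 0 ≤ R) :
    ∫ r in Set.Ioi (0 : ℝ), r ^ d * |extremal d δ R r| ^ t ≤ B ^ t * Real.log (R + 1) := by
  have hcont : Continuous fun r => r ^ d * |extremal d δ R r| ^ t :=
    (continuous_pow d).mul ((continuous_extremal hδ R).abs.rpow_const fun _ => .inr ht.le)
  have hsupp : ∫ r in Set.Ioi (0 : ℝ), r ^ d * |extremal d δ R r| ^ t =
      ∫ r in (1 : ℝ)..R + 1, r ^ d * |extremal d δ R r| ^ t := by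
    rw [intervalIntegral.integral_of_le (by linarith)]
    refine setIntegral_eq_of_subset_of_forall_sdiff_eq_zero measurableSet_Ioi
      (fun r hr => one_pos.trans hr.1) fun r hr => ?_
    have hzero : extremal d δ R r = 0 := by
      rcases le_or_gt r 1 with h | h
      · exact extremal_eq_zero_of_le_one h
      · exact extremal_eq_zero_of_add_one_le (not_le.1 fun hle => hr.2 ⟨h, hle⟩).le
    rw [hzero, abs_zero, Real.zero_rpow ht.ne', mul_zero]
  have hlog : ∫ r in (1 : ℝ)..R + 1, B ^ t * r⁻¹ = B ^ t * Real.log (R + 1) := by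
    rw [intervalIntegral.integral_const_mul, integral_inv_of_pos one_pos (by linarith), div_one]
  rw [hsupp, ← hlog]
  refine intervalIntegral.integral_mono_on (by linarith) (hcont.intervalIntegrable _ _)
    ((intervalIntegral.intervalIntegrable_inv (fun r hr => ?_) continuousOn_id).const_mul _)
    fun r hr => ?_
  · rw [Set.uIcc_of_le (by linarith)] at hr
    exact (one_pos.trans_le hr.1).ne'
  · have hr₀ : 0 < r := one_pos.trans_le hr.1
    calc r ^ d * |extremal d δ R r| ^ t ≤ r ^ d * (B * r ^ (δ - d / 2)) ^ t := by
          gcongr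
          exact hB R r hr.1
      _ = B ^ t * (r ^ d * r ^ ((δ - d / 2) * t)) := by
          rw [Real.mul_rpow hB₀ (by positivity), ← Real.rpow_mul hr₀.le]
          ring
      _ ≤ B ^ t * (r ^ d * r ^ (-(d + 1) : ℝ)) := by
          gcongr
          exact hr.1
      _ = B ^ t * r⁻¹ := by
          rw [← Real.rpow_natCast, ← Real.rpow_add hr₀, ← Real.rpow_neg_one]
          congr 2
          ring

theorem toReal_eLpNorm_extremal_le (hδ : 0 < δ) {B : ℝ} (hB₀ : 0 ≤ B)
    (hB : ∀ R r, 1 ≤ r → |extremal d δ R r| ≤ B * r ^ (δ - d / 2)) {q : ℝ≥0∞} (hq : 1 ≤ q)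
    (hcrit : (d + 1) * (q⁻¹).toReal ≤ d / 2 - δ) {R : ℝ} (hR : 0 ≤ R) :
    (eLpNorm (fun y : EuclideanSpace ℝ (Fin (d + 1)) => extremal d δ R ‖y‖) q volume).toReal ≤
      B * (sphereArea d * Real.log (R + 1)) ^ (q⁻¹).toReal := by
  rcases eq_or_ne q ∞ with rfl | hq_top
  · simp only [ENNReal.inv_top, ENNReal.toReal_zero, mul_zero, Real.rpow_zero, mul_one,
      eLpNorm_exponent_top] at hcrit ⊢
    refine ENNReal.toReal_le_of_le_ofReal hB₀
      (eLpNormEssSup_le_of_ae_bound (ae_of_all _ fun y => ?_))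
    rcases le_or_gt ‖y‖ 1 with hy | hy
    · rwa [extremal_eq_zero_of_le_one hy, norm_zero]
    · exact (hB R _ hy.le).trans (mul_le_of_le_one_right hB₀
        (Real.rpow_le_one_of_one_le_of_nonpos hy.le (by linarith)))
  · have hq₀ : q ≠ 0 := (one_pos.trans_le hq).ne'
    have ht : 0 < q.toReal := ENNReal.toReal_pos hq₀ hq_top
    have hlog : 0 ≤ Real.log (R + 1) := Real.log_nonneg (by linarith)
    have hS : 0 ≤ sphereArea d := sphereArea_pos.le
    rw [ENNReal.toReal_inv] at hcrit ⊢
    have hcrit' : (δ - d / 2) * q.toReal ≤ -(d + 1) := by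
      calc (δ - d / 2) * q.toReal ≤ -((d + 1) * q.toReal⁻¹) * q.toReal := by
            gcongr
            linarith
        _ = -(d + 1) := by field_simp
    have hcont : Continuous fun y : EuclideanSpace ℝ (Fin (d + 1)) => extremal d δ R ‖y‖ :=
      (continuous_extremal hδ R).comp continuous_norm
    rw [toReal_eLpNorm_eq_integral hcont.aestronglyMeasurable hq₀ hq_top, ENNReal.toReal_inv]
    simp only [Real.norm_eq_abs]
    rw [integral_comp_norm fun r => |extremal d δ R r| ^ q.toReal]
    calc _ ≤ (sphereArea d * (B ^ q.toReal * Real.log (R + 1))) ^ q.toReal⁻¹ := by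
          refine Real.rpow_le_rpow (mul_nonneg hS (setIntegral_nonneg measurableSet_Ioi
            fun r hr => mul_nonneg (pow_nonneg (Set.mem_Ioi.1 hr).le d) (by positivity))) ?_
            (by positivity)
          gcongr
          exact integral_abs_extremal_rpow_le hδ hB₀ hB ht hcrit' hR
      _ = B * (sphereArea d * Real.log (R + 1)) ^ q.toReal⁻¹ := by
          rw [mul_left_comm, Real.mul_rpow (by positivity) (by positivity),
            Real.rpow_rpow_inv hB₀ ht.ne']

theorem exists_toReal_eLpNorm_extremal_le (hδ : 0 < δ) {q : ℝ≥0∞} (hq : 1 ≤ q)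
    (hcrit : (d + 1) * (q⁻¹).toReal ≤ d / 2 - δ) :
    ∃ B, ∀ R, Real.exp 1 ≤ R →
      (eLpNorm (fun y : EuclideanSpace ℝ (Fin (d + 1)) => extremal d δ R ‖y‖) q volume).toReal ≤
        B * √(Real.log R) := by
  obtain ⟨B, hB₀, hB⟩ := exists_abs_extremal_le (d := d) hδ
  have hS : 0 ≤ sphereArea d := sphereArea_pos.le
  have hexp : (2 : ℝ) ≤ Real.exp 1 := by linarith [Real.add_one_le_exp 1]
  have hhalf : (q⁻¹).toReal ≤ 1 / 2 := by nlinarith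
  refine ⟨B * (sphereArea d * 2) ^ (q⁻¹).toReal, fun R hR => ?_⟩
  have hR₀ : 0 < R := by linarith
  have hlog : 1 ≤ Real.log R := (Real.le_log_iff_exp_le hR₀).2 hR
  have hlog_succ : Real.log (R + 1) ≤ 2 * Real.log R := by
    rw [← Real.log_rpow hR₀, Real.rpow_two]
    exact Real.log_le_log (by linarith) (by nlinarith)
  calc _ ≤ B * (sphereArea d * Real.log (R + 1)) ^ (q⁻¹).toReal :=
        toReal_eLpNorm_extremal_le hδ hB₀ hB hq hcrit hR₀.le
    _ ≤ B * (sphereArea d * (2 * Real.log R)) ^ (q⁻¹).toReal := by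
        gcongr
        exact mul_nonneg hS (Real.log_nonneg (by linarith))
    _ = B * (sphereArea d * 2) ^ (q⁻¹).toReal * Real.log R ^ (q⁻¹).toReal := by
        rw [← mul_assoc, Real.mul_rpow (by positivity) (by positivity), mul_assoc]
    _ ≤ B * (sphereArea d * 2) ^ (q⁻¹).toReal * √(Real.log R) := by
        rw [Real.sqrt_eq_rpow]
        gcongr

end Extremal

/-! ### Divergence up to the critical line -/

theorem exists_mul_sqrt_lt_mul_sub {a : ℝ} (ha : 0 < a) (b c : ℝ) :
    ∃ L, 1 ≤ L ∧ c * √L < a * L - b := by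
  have hlim : Tendsto (fun x : ℝ => x * (a * x - c)) atTop atTop :=
    tendsto_id.atTop_mul_atTop₀ (tendsto_atTop_add_const_right _ _ (tendsto_id.const_mul_atTop ha))
  obtain ⟨x, hx, hbx⟩ := ((eventually_ge_atTop 1).and (hlim.eventually_gt_atTop b)).exists
  refine ⟨x ^ 2, one_le_pow₀ hx, ?_⟩
  rw [Real.sqrt_sq (by linarith)]
  linarith

theorem not_exists_multiplierBound (p : ℝ≥0∞) [Fact (1 ≤ p)] {δ : ℝ} (hδ : 0 < δ) {q q' : ℝ≥0∞}
    [ENNReal.HolderConjugate q q'] (hqp : q = p ∨ q' = p)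
    (hcrit : (d + 1) * (q'⁻¹).toReal ≤ d / 2 - δ) :
    ¬ ∃ C, ∀ n : ℕ, MultiplierBound (characterLp p (d := d + 1)) C
      fun k => (weight 2 δ (n + 1) k : ℂ) := by
  rintro ⟨C, hC⟩
  obtain ⟨K, hK, hupper⟩ := exists_abs_integral_rieszKernel_mul_le (q := q) (q' := q') hδ hC hqp
  obtain ⟨B, hB⟩ := exists_toReal_eLpNorm_extremal_le hδ
    (ENNReal.HolderConjugate.one_le q' q) hcrit
  obtain ⟨a, b, ha, hlower⟩ := exists_log_le_integral_rieszKernel_mul_extremal (d := d) hδ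
  obtain ⟨L, hL, hlt⟩ := exists_mul_sqrt_lt_mul_sub ha b (K * B)
  refine hlt.not_ge ?_
  calc a * L - b ≤ ∫ y : EuclideanSpace ℝ (Fin (d + 1)),
        rieszKernel δ y * extremal d δ (Real.exp L) ‖y‖ := by
        simpa using hlower (Real.exp L) (by linarith [Real.add_one_le_exp L])
    _ ≤ K * _ := (le_abs_self _).trans (hupper _ (Real.exp L + 1) (continuous_extremal hδ _)
        fun r hr => extremal_eq_zero_of_add_one_le hr)
    _ ≤ K * (B * √L) := by
        gcongr
        simpa using hB (Real.exp L) (Real.exp_le_exp.2 hL)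
    _ = K * B * √L := (mul_assoc _ _ _).symm

theorem not_convergesInLp (p : ℝ≥0∞) [hp : Fact (1 ≤ p)] {β δ : ℝ} (hβ : 0 < β) (hδ : 0 < δ)
    (hcrit : δ ≤ (d + 1) * |(p⁻¹).toReal - 1 / 2| - 1 / 2) :
    ¬ ConvergesInLp p (mean (d + 1) β δ) := by
  intro hconv
  have hbound := (convergesInLp_mean_iff two_pos hδ).1
    (ConvergesInLp.of_exponent p two_pos hβ hδ hconv)
  have hconj := ENNReal.HolderConjugate.inv_one_sub_inv' hp.out
  have hsum := toReal_inv_add_toReal_inv p (1 - p⁻¹)⁻¹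
  rcases le_total (1 / 2) (p⁻¹).toReal with h | h
  · rw [abs_of_nonneg (by linarith)] at hcrit
    refine not_exists_multiplierBound p hδ (q := p) (q' := (1 - p⁻¹)⁻¹) (.inl rfl) ?_ hbound
    rw [eq_sub_of_add_eq' hsum]
    linarith
  · rw [abs_of_nonpos (by linarith)] at hcrit
    have := hconj.symm
    exact not_exists_multiplierBound p hδ (q := (1 - p⁻¹)⁻¹) (q' := p) (.inr rfl) (by linarith)
      hbound

end BochnerRiesz

end

/-- Here `(p⁻¹).toReal` is `1/p`, with `1/∞ = 0`; to diverge in `L_p` is not to converge there. -/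
theorem theorem2p1 (d : ℕ) (hd : 1 ≤ d) (p : ℝ≥0∞) (hp : 1 ≤ p) (β δ : ℝ)
    (hβ : 0 < β) (hδ : 0 < δ) :
    (BochnerRiesz.ConvergesInLp p (BochnerRiesz.mean d β δ) ↔
      BochnerRiesz.ConvergesInLp p (BochnerRiesz.classicalMean d δ)) ∧
    (((p⁻¹).toReal, δ) ∈ BochnerRiesz.SigmaRegion d →
      BochnerRiesz.ConvergesInLp p (BochnerRiesz.mean d β δ)) ∧
    (((p⁻¹).toReal, δ) ∈ BochnerRiesz.GammaRegion d →
      ¬ BochnerRiesz.ConvergesInLp p (BochnerRiesz.mean d β δ)) := by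
  have : Fact (1 ≤ p) := ⟨hp⟩
  obtain ⟨d, rfl⟩ : ∃ e, d = e + 1 := ⟨d - 1, by omega⟩
  refine ⟨⟨fun h => h.of_exponent p two_pos hβ hδ, fun h => h.of_exponent p hβ two_pos hδ⟩,
    fun ⟨_, _, hδp⟩ => ?_, fun ⟨_, _, hδp⟩ => ?_⟩
  · have hcrit := (le_max_left _ _).trans_lt hδp
    push_cast at hcrit
    exact BochnerRiesz.convergesInLp_of_critical_lt p hβ (by linarith)
  · push_cast at hδp
    exact BochnerRiesz.not_convergesInLp p hβ hδ hδp
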